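/- **Setting.** Let $(X,d)$ be a compact metric space with a finite non-zero Borel measure $\omega$, and let $1<p<\infty$, $p\neq 2$, $\varepsilon>0$. Let $\Omega_X$ be the set of continuous maps $F:X\to X$ with $F_\#\omega\ll\omega$ for which the Koopman operator $\mathcal K_Ff=f\circ F$ is bounded on $L^p(X,\omega)$, and let $\Omega_X^m\subset\Omega_X$ be the set of continuous $F$ with $F_\#\omega=\omega$. Put $$\sigma_{\mathrm{ap}}(\mathcal K_F)=\{\lambda\in\mathbb C:\exists (f_n)\subset L^p,\ \|f_n\|_p=1,\ \|(\mathcal K_F-\lambda)f_n\|_p\to0\},$$ $$\sigma_{\mathrm{ap},\varepsilon}(\mathcal K_F)=\overline{\{\lambda\in\mathbb C:\exists f\in L^p,\ \|f\|_p=1,\ \|(\mathcal K_F-\lambda)f\|_p<\varepsilon\}}.$$ Both are elements of $\mathcal M_H$, the non-empty compact subsets of $\mathbb C$ with the Hausdorff metric $d_H$. **Computational problems.** For $\Omega\in\{\Omega_X,\Omega_X^m\}$ and $\Xi\in\{\sigma_{\mathrm{ap}},\sigma_{\mathrm{ap},\varepsilon}\}$ consider the problem of computing $\Xi(\mathcal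 K_F)$, $F\in\Omega$, from the point evaluations $\Lambda=\{F\mapsto F(x):x\in X\}$ with $\Delta_1$-information: an input is any table $A=(a_{x,n})_{x\in X,n\in\mathbb N}$ in $X$ such that for some $F\in\Omega$ one has $d(a_{x,n},F(x))\le2^{-n}$ for all $x,n$; its value is $\Xi(A):=\Xi(\mathcal K_F)$; the readable evaluations are the entries $a_{x,n}$. A *general algorithm* is a map $\Gamma$ from inputs to $\mathcal M_H$ such that to each input $A$ belongs a non-empty finite set $\Lambda_\Gamma(A)$ of evaluations, and whenever an input $B$ agrees with $A$ on $\Lambda_\Gamma(A)$, then $\Lambda_\Gamma(B)=\Lambda_\Gamma(A)$ and $\Gamma(B)=\Gamma(A)$. A *tower of height $k$* is a family of maps $\Gamma_{n_k},\Gamma_{n_k,n_{k-1}},\dots,\Gamma_{n_k,\dots,n_1}$ from inputs to $\mathcal M_H$, the last ones being general algorithms, with $\Xi(A)=\lim_{n_k}\Gamma_{n_k}(A)$, $\Gamma_{n_k}(A)=\lim_{n_{k-1}}\Gamma_{n_k,n_{k-1}}(A)$, …, for every input $A$. For $k\ge1$ the problem belongs to $\Sigma_k^G$ if there are a tower of height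 $k$ and sets $X_n(A)\in\mathcal M_H$ such that $\Gamma_{n}(A)\subset X_{n}(A)$ and $d_H(X_{n}(A),\Xi(A))\le2^{-n}$ for all $A$ and all $n=n_k$. It belongs to $\Pi_k^G$ if there are a tower of height $k$ and sets $X_n(A)\in\mathcal M_H$ such that $\Xi(A)\subset X_{n}(A)$ and $d_H(X_{n}(A),\Gamma_{n}(A))\le2^{-n}$ for all $A$ and all $n=n_k$. **Upper bounds.** For all such $(X,d,\omega)$, $p$ and $\varepsilon$, both on $\Omega_X^m$ and on $\Omega_X$, the problem of computing $\sigma_{\mathrm{ap},\varepsilon}$ belongs to $\Sigma_2^G$ and the problem of computing $\sigma_{\mathrm{ap}}$ belongs to $\Pi_3^G$. **Sharpness.** Let $K\subset[0,1]$ be the middle-third Cantor set and $X^*=\mathbb T^1\times K$ with the product metric. There is a non-atomic Borel probability measure $\nu$ on $K$ such that, with $\omega^*=\lambda_{\mathbb T}\otimes\nu$ ($\lambda_{\mathbb T}$ the Haar probability measure on $\mathbb T^1$), for all $1<p<\infty$ with $p\ne2$ and all $\varepsilon>0$, both on $\Omega_{X^*}^m$ and on $\Omega_{X^*}$, the problem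 of computing $\sigma_{\mathrm{ap},\varepsilon}$ does not belong to $\Sigma_1^G$ and the problem of computing $\sigma_{\mathrm{ap}}$ does not belong to $\Pi_2^G$. -/

import Mathlib

open MeasureTheory Filter Topology TopologicalSpace
open scoped ENNReal NNReal

/-! ### Computational problems, general algorithms, towers, the SCI hierarchy -/

/-- A computational problem with values in the metric space `M`. The evaluation set is the indexed
family `eval`, whose members take their values in the metric space `V`; by `separates`, it
separates any two inputs at which the problem function `Xi` differs. -/
structure CompProblem.{u, v} (M : Type u) (V : Type v) where
  /-- the primary set -/
  Input : Type v
  /-- the index set of the evaluation set -/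
  Index : Type v
  /-- the evaluation set -/
  eval : Index → Input → V
  /-- the problem function -/
  Xi : Input → M
  separates : ∀ A B : Input, Xi A ≠ Xi B → ∃ i, eval i A ≠ eval i B

namespace CompProblem

variable {M V : Type*}

/-- `Γ` is a general algorithm: to every input `A` belongs a non-empty finite set `Q A` of
evaluations, and any input that agrees with `A` on `Q A` has the same set of evaluations and
the same output as `A`. -/
def IsGeneralAlgorithm (P : CompProblem M V) (Γ : P.Input → M) : Prop :=
  ∃ Q : P.Input → Finset P.Index,
    ∀ A, (Q A).Nonempty ∧
      ∀ B, (∀ i ∈ Q A, P.eval i A = P.eval i B) → Q A = Q B ∧ Γ A = Γ B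

/-- A tower of general algorithms of height `k`. For a list `l = [n_k, …, n_{j+1}]` of length
`k - j`, the function `Γ l` is `Γ_{n_k, …, n_{j+1}}`; lists longer than `k` play no role. -/
structure IsTower [MetricSpace M] (P : CompProblem M V) (k : ℕ)
    (Γ : List ℕ → P.Input → M) : Prop where
  base : ∀ l : List ℕ, l.length = k → P.IsGeneralAlgorithm (Γ l)
  lim : ∀ l : List ℕ, l.length < k → ∀ A,
    Tendsto (fun n : ℕ => Γ (l ++ [n]) A) atTop (𝓝 (Γ l A))
  top : ∀ A, Γ [] A = P.Xi A

/-- The solvability complexity index of `P` with respect to general towers is at most `k`. -/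
def SCILe [MetricSpace M] (P : CompProblem M V) (k : ℕ) : Prop :=
  ∃ j ≤ k, ∃ Γ : List ℕ → P.Input → M, P.IsTower j Γ

/-- The classes `Δ_k^G`. -/
def InDelta [MetricSpace M] (P : CompProblem M V) : ℕ → Prop
  | 0 => P.SCILe 0
  | 1 => ∃ Γ : ℕ → P.Input → M, (∀ n, P.IsGeneralAlgorithm (Γ n)) ∧
      ∀ n A, dist (Γ n A) (P.Xi A) ≤ (2 : ℝ)⁻¹ ^ n
  | k + 2 => P.SCILe (k + 1)

/-- The classes `Σ_m^G` for problems with values in the non-empty compact subsets of `ℂ`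
with the Hausdorff metric. -/
def InSigma (P : CompProblem (NonemptyCompacts ℂ) V) : ℕ → Prop
  | 0 => P.InDelta 0
  | m + 1 => P.InDelta (m + 2) ∧
      ∃ Γ : List ℕ → P.Input → NonemptyCompacts ℂ, P.IsTower (m + 1) Γ ∧
        ∃ X : ℕ → P.Input → NonemptyCompacts ℂ, ∀ A,
          (∀ n, (Γ [n] A : Set ℂ) ⊆ X n A) ∧
          Tendsto (fun n => Γ [n] A) atTop (𝓝 (P.Xi A)) ∧
          ∀ n, dist (X n A) (P.Xi A) ≤ (2 : ℝ)⁻¹ ^ n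

/-- The classes `Π_m^G` for problems with values in the non-empty compact subsets of `ℂ`
with the Hausdorff metric. -/
def InPi (P : CompProblem (NonemptyCompacts ℂ) V) : ℕ → Prop
  | 0 => P.InDelta 0
  | m + 1 => P.InDelta (m + 2) ∧
      ∃ Γ : List ℕ → P.Input → NonemptyCompacts ℂ, P.IsTower (m + 1) Γ ∧
        ∃ X : ℕ → P.Input → NonemptyCompacts ℂ, ∀ A,
          (∀ n, (P.Xi A : Set ℂ) ⊆ X n A) ∧
          Tendsto (fun n => Γ [n] A) atTop (𝓝 (P.Xi A)) ∧
          ∀ n, dist (X n A) (Γ [n] A) ≤ (2 : ℝ)⁻¹ ^ n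

section Delta1

variable [MetricSpace V]

/-- The table `a` of values in `V` is `Δ₁`-information about the input `A` of `P`. -/
def IsDelta1Info (P : CompProblem M V) (a : P.Index × ℕ → V) (A : P.Input) : Prop :=
  ∀ i n, dist (a (i, n)) (P.eval i A) ≤ (2 : ℝ)⁻¹ ^ n

theorem xi_eq_of_isDelta1Info (P : CompProblem M V) {a : P.Index × ℕ → V} {A B : P.Input}
    (hA : P.IsDelta1Info a A) (hB : P.IsDelta1Info a B) : P.Xi A = P.Xi B := by
  by_contra h
  obtain ⟨i, hi⟩ := P.separates A B h
  have h0 : Tendsto (fun n : ℕ => (2 : ℝ)⁻¹ ^ n) atTop (𝓝 0) :=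
    tendsto_pow_atTop_nhds_zero_of_lt_one (by norm_num) (by norm_num)
  have key : ∀ C, P.IsDelta1Info a C →
      Tendsto (fun n : ℕ => a (i, n)) atTop (𝓝 (P.eval i C)) := fun C hC =>
    tendsto_iff_dist_tendsto_zero.2 (squeeze_zero (fun _ => dist_nonneg) (hC i) h0)
  exact hi (tendsto_nhds_unique (key A hA) (key B hB))

/-- The computational problem with `Δ₁`-information: the inputs are all tables of approximations,
with error at most `2⁻ⁿ`, of the evaluations of an input `A` of `P`; the value of the problem
function at such a table is `Ξ(A)`, and an algorithm reads entries of the table. -/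
noncomputable def delta1 (P : CompProblem M V) : CompProblem M V where
  Input := {a : P.Index × ℕ → V // ∃ A, P.IsDelta1Info a A}
  Index := P.Index × ℕ
  eval i a := a.1 i
  Xi a := P.Xi a.2.choose
  separates a b h := by
    by_contra! hab
    exact h (congrArg (fun c => P.Xi c.2.choose) (Subtype.ext (funext hab)))

/-- The problem function with `Δ₁`-information does not depend on the choice in `delta1`. -/
theorem delta1_xi (P : CompProblem M V) (a : P.delta1.Input) {A : P.Input}
    (hA : P.IsDelta1Info a.1 A) : P.delta1.Xi a = P.Xi A :=
  P.xi_eq_of_isDelta1Info a.2.choose_spec hA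

end Delta1

end CompProblem

/-! ### Approximate point spectrum and approximate point pseudospectrum -/

section Spectra

variable {E : Type*} [NormedAddCommGroup E] [NormedSpace ℂ E]

/-- The approximate point spectrum. -/
def sigmaAp (T : E →L[ℂ] E) : Set ℂ :=
  {z | ∃ f : ℕ → E, (∀ n, ‖f n‖ = 1) ∧ Tendsto (fun n => ‖T (f n) - z • f n‖) atTop (𝓝 0)}

/-- The approximate point `ε`-pseudospectrum. -/
def sigmaApEps (ε : ℝ) (T : E →L[ℂ] E) : Set ℂ :=
  closure {z | ∃ f : E, ‖f‖ = 1 ∧ ‖T f - z • f‖ < ε}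

theorem mem_sigmaAp_iff (T : E →L[ℂ] E) (z : ℂ) :
    z ∈ sigmaAp T ↔ ∀ δ : ℝ, 0 < δ → ∃ f : E, ‖f‖ = 1 ∧ ‖T f - z • f‖ < δ := by
  constructor
  · rintro ⟨f, hf, hlim⟩ δ hδ
    obtain ⟨n, hn⟩ := (hlim.eventually (gt_mem_nhds hδ)).exists
    exact ⟨f n, hf n, hn⟩
  · intro h
    choose f hf hlt using fun n : ℕ => h (1 / ((n : ℝ) + 1)) (by positivity)
    exact ⟨f, hf, squeeze_zero (fun _ => norm_nonneg _) (fun n => (hlt n).le)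
      tendsto_one_div_add_atTop_nhds_zero_nat⟩

theorem norm_le_of_almost_eigenvector (T : E →L[ℂ] E) {z : ℂ} {f : E} {δ : ℝ} (hf : ‖f‖ = 1)
    (h : ‖T f - z • f‖ < δ) : ‖z‖ ≤ ‖T‖ + δ := by
  have h1 : ‖z • f‖ ≤ ‖T f‖ + ‖T f - z • f‖ := by
    have := norm_sub_le (T f) (T f - z • f)
    rwa [sub_sub_cancel] at this
  rw [norm_smul, hf, mul_one] at h1
  have h2 := T.le_opNorm f
  rw [hf, mul_one] at h2
  linarith

theorem isCompact_sigmaApEps (ε : ℝ) (T : E →L[ℂ] E) : IsCompact (sigmaApEps ε T) := by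
  refine (isCompact_closedBall (0 : ℂ) (‖T‖ + ε)).of_isClosed_subset isClosed_closure
    (closure_minimal ?_ Metric.isClosed_closedBall)
  rintro z ⟨f, hf, h⟩
  simpa using norm_le_of_almost_eigenvector T hf h

theorem isCompact_sigmaAp (T : E →L[ℂ] E) : IsCompact (sigmaAp T) := by
  refine (isCompact_closedBall (0 : ℂ) (‖T‖ + 1)).of_isClosed_subset ?_ ?_
  · refine isClosed_of_closure_subset fun z hz => (mem_sigmaAp_iff T z).2 fun δ hδ => ?_
    obtain ⟨w, hw, hd⟩ := Metric.mem_closure_iff.1 hz (δ / 2) (by positivity)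
    obtain ⟨f, hf, h⟩ := (mem_sigmaAp_iff T w).1 hw (δ / 2) (by positivity)
    refine ⟨f, hf, ?_⟩
    have h1 : T f - z • f = (T f - w • f) + (w - z) • f := by rw [sub_smul]; abel
    have h2 : ‖(w - z) • f‖ < δ / 2 := by
      rw [norm_smul, hf, mul_one, ← dist_eq_norm, dist_comm]; exact hd
    rw [h1]
    linarith [norm_add_le (T f - w • f) ((w - z) • f)]
  · intro z hz
    obtain ⟨f, hf, h⟩ := (mem_sigmaAp_iff T z).1 hz 1 one_pos
    simpa using norm_le_of_almost_eigenvector T hf h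

variable [CompleteSpace E] [Nontrivial E]

/-- A point of the spectrum with maximal real part is an approximate eigenvalue. -/
theorem sigmaAp_nonempty (T : E →L[ℂ] E) : (sigmaAp T).Nonempty := by
  obtain ⟨z, hz, hmax⟩ := (spectrum.isCompact (𝕜 := ℂ) T).exists_isMaxOn (spectrum.nonempty T)
    Complex.continuous_re.continuousOn
  refine ⟨z, ?_⟩
  rw [mem_sigmaAp_iff]
  by_contra! hcon
  obtain ⟨δ, hδ, hbd⟩ := hcon
  have hbd' : ∀ f : E, δ * ‖f‖ ≤ ‖T f - z • f‖ := by
    intro f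
    rcases eq_or_ne f 0 with rfl | hf
    · simp
    have hn : 0 < ‖f‖ := norm_pos_iff.2 hf
    have h1 := hbd (((‖f‖⁻¹ : ℝ) : ℂ) • f) (by
      rw [norm_smul, Complex.norm_real, norm_inv, norm_norm, inv_mul_cancel₀ hn.ne'])
    rw [map_smul, smul_comm z, ← smul_sub, norm_smul, Complex.norm_real, norm_inv,
      norm_norm] at h1
    have h2 := mul_le_mul_of_nonneg_left h1 hn.le
    rw [mul_inv_cancel_left₀ hn.ne'] at h2
    linarith
  set w : ℂ := z + ((δ / 4 : ℝ) : ℂ) with hw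
  have hwz : ‖w - z‖ = δ / 4 := by
    rw [hw, add_sub_cancel_left, Complex.norm_real, Real.norm_of_nonneg (by positivity)]
  have hwn : w ∉ spectrum ℂ T := by
    intro hmem
    have h1 : w.re ≤ z.re := hmax hmem
    rw [hw, Complex.add_re, Complex.ofReal_re] at h1
    linarith
  rw [spectrum.notMem_iff] at hwn
  obtain ⟨u, hu⟩ := hwn
  have hlow : ∀ f : E, 3 * δ / 4 * ‖f‖ ≤ ‖(u : E →L[ℂ] E) f‖ := by
    intro f
    have h1 : (u : E →L[ℂ] E) f = (w - z) • f - (T f - z • f) := by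
      rw [hu]
      simp only [sub_apply, Algebra.algebraMap_eq_smul_one,
        smul_apply, one_apply_eq_self, sub_smul]
      abel
    have h2 : ‖T f - z • f‖ ≤ ‖(w - z) • f‖ + ‖(u : E →L[ℂ] E) f‖ := by
      have h3 : T f - z • f = (w - z) • f - (u : E →L[ℂ] E) f := by rw [h1]; abel
      rw [h3]
      exact norm_sub_le _ _
    rw [norm_smul, hwz] at h2
    linarith [hbd' f]
  have hinv : ‖((u⁻¹ : (E →L[ℂ] E)ˣ) : E →L[ℂ] E)‖ ≤ (3 * δ / 4)⁻¹ := by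
    refine ContinuousLinearMap.opNorm_le_bound _ (by positivity) fun f => ?_
    have h1 := hlow (((u⁻¹ : (E →L[ℂ] E)ˣ) : E →L[ℂ] E) f)
    have h2 : (u : E →L[ℂ] E) (((u⁻¹ : (E →L[ℂ] E)ˣ) : E →L[ℂ] E) f) = f := by
      rw [← mul_apply_eq_comp, u.mul_inv, one_apply_eq_self]
    rw [h2] at h1
    rw [inv_mul_eq_div, le_div_iff₀ (by positivity)]
    linarith
  have hpos : 0 < ‖((u⁻¹ : (E →L[ℂ] E)ˣ) : E →L[ℂ] E)‖ := Units.norm_pos _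
  have hunit : IsUnit (algebraMap ℂ (E →L[ℂ] E) z - T) := by
    refine ⟨Units.ofNearby u (algebraMap ℂ (E →L[ℂ] E) z - T) ?_, rfl⟩
    have h1 : algebraMap ℂ (E →L[ℂ] E) z - T - u = algebraMap ℂ (E →L[ℂ] E) (z - w) := by
      rw [hu, map_sub]; abel
    rw [h1, norm_algebraMap', norm_sub_rev, hwz]
    calc δ / 4 < 3 * δ / 4 := by linarith
      _ ≤ _ := by
        rw [le_inv_comm₀ (by positivity) hpos]
        exact hinv
  exact (spectrum.notMem_iff.2 hunit) hz

theorem sigmaApEps_nonempty {ε : ℝ} (hε : 0 < ε) (T : E →L[ℂ] E) :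
    (sigmaApEps ε T).Nonempty := by
  obtain ⟨z, hz⟩ := sigmaAp_nonempty T
  exact ⟨z, subset_closure ((mem_sigmaAp_iff T z).1 hz ε hε)⟩

/-- The approximate point spectrum as a non-empty compact subset of `ℂ`. -/
def sigmaApCompact (T : E →L[ℂ] E) : NonemptyCompacts ℂ :=
  ⟨⟨sigmaAp T, isCompact_sigmaAp T⟩, sigmaAp_nonempty T⟩

/-- The approximate point `ε`-pseudospectrum as a non-empty compact subset of `ℂ`. -/
def sigmaApEpsCompact (ε : ℝ) (hε : 0 < ε) (T : E →L[ℂ] E) : NonemptyCompacts ℂ :=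
  ⟨⟨sigmaApEps ε T, isCompact_sigmaApEps ε T⟩, sigmaApEps_nonempty hε T⟩

end Spectra

/-! ### Koopman operators on `L^p` -/

section Koopman

variable {X : Type*} [MetricSpace X] [MeasurableSpace X] [BorelSpace X]

/-- The class `Ω_X` of continuous, nonsingular maps with bounded Koopman operator on `L^p`. -/
def generalClass (p : ℝ≥0∞) (ω : Measure X) : Set C(X, X) :=
  {F | Measure.map F ω ≪ ω ∧
    ∃ C : ℝ≥0, ∀ f : X → ℂ, MemLp f p ω → eLpNorm (f ∘ F) p ω ≤ C * eLpNorm f p ω}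

/-- The class `Ω_X^m` of continuous, measure-preserving maps. -/
def measurePreservingClass (ω : Measure X) : Set C(X, X) :=
  {F | Measure.map F ω = ω}

theorem measurePreservingClass_subset (p : ℝ≥0∞) (ω : Measure X) :
    measurePreservingClass ω ⊆ generalClass p ω := by
  intro F hF
  have hmp : MeasurePreserving F ω ω := ⟨F.continuous.measurable, hF⟩
  refine ⟨hmp.quasiMeasurePreserving.absolutelyContinuous, 1, fun f hf => ?_⟩
  rw [eLpNorm_comp_measurePreserving hf.1 hmp]
  simp

variable {p : ℝ≥0∞} {ω : Measure X}

theorem quasiMeasurePreserving_of_mem {F : C(X, X)} (hF : F ∈ generalClass p ω) :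
    Measure.QuasiMeasurePreserving F ω ω :=
  ⟨F.continuous.measurable, hF.1⟩

theorem memLp_comp_of_mem {F : C(X, X)} (hF : F ∈ generalClass p ω) {f : X → ℂ}
    (hf : MemLp f p ω) : MemLp (f ∘ F) p ω := by
  obtain ⟨C, hC⟩ := hF.2
  exact ⟨hf.1.comp_quasiMeasurePreserving (quasiMeasurePreserving_of_mem hF),
    (hC f hf).trans_lt (ENNReal.mul_lt_top ENNReal.coe_lt_top hf.2)⟩

variable [Fact (1 ≤ p)]

/-- The Koopman operator `f ↦ f ∘ F` on `L^p(X, ω)`. -/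
noncomputable def koopman (F : C(X, X)) (hF : F ∈ generalClass p ω) :
    Lp ℂ p ω →L[ℂ] Lp ℂ p ω :=
  LinearMap.mkContinuousOfExistsBound
    { toFun := fun f => (memLp_comp_of_mem hF (Lp.memLp f)).toLp (f ∘ F)
      map_add' := fun f g => by
        rw [← MemLp.toLp_add]
        exact MemLp.toLp_congr _ _
          ((quasiMeasurePreserving_of_mem hF).ae_eq_comp (Lp.coeFn_add f g))
      map_smul' := fun c f => by
        rw [RingHom.id_apply, ← MemLp.toLp_const_smul]
        exact MemLp.toLp_congr _ _
          ((quasiMeasurePreserving_of_mem hF).ae_eq_comp (Lp.coeFn_smul c f)) }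
    (by
      obtain ⟨C, hC⟩ := hF.2
      refine ⟨C, fun f => ?_⟩
      simp only [LinearMap.coe_mk, AddHom.coe_mk]
      rw [Lp.norm_toLp, Lp.norm_def, ← ENNReal.coe_toReal C, ← ENNReal.toReal_mul]
      exact ENNReal.toReal_mono
        (ENNReal.mul_lt_top ENNReal.coe_lt_top (Lp.memLp f).2).ne (hC f (Lp.memLp f)))

theorem koopman_coeFn (F : C(X, X)) (hF : F ∈ generalClass p ω) (f : Lp ℂ p ω) :
    koopman F hF f =ᵐ[ω] f ∘ F :=
  (memLp_comp_of_mem hF (Lp.memLp f)).coeFn_toLp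

instance nontrivial_Lp_of_neZero [IsFiniteMeasure ω] [NeZero ω] : Nontrivial (Lp ℂ p ω) := by
  refine ⟨⟨Lp.const p ω (1 : ℂ), 0, fun h => ?_⟩⟩
  have h1 : (fun _ : X => (1 : ℂ)) =ᵐ[ω] 0 := by
    refine (Lp.coeFn_const (p := p) (μ := ω) (1 : ℂ)).symm.trans ?_
    rw [h]
    exact Lp.coeFn_zero ℂ p ω
  have : (ae ω).NeBot := inferInstance
  obtain ⟨x, hx⟩ := h1.exists
  exact one_ne_zero hx

/-- The problem of computing `spec (K_F)` from the point evaluations `F ↦ F x`, `x ∈ X`, where `F`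
ranges over the class `S` and `K_F` is the Koopman operator of `F` on `L^p(X, ω)`. -/
noncomputable def koopmanProblem (spec : (Lp ℂ p ω →L[ℂ] Lp ℂ p ω) → NonemptyCompacts ℂ)
    (S : Set C(X, X)) (hS : S ⊆ generalClass p ω) : CompProblem (NonemptyCompacts ℂ) X where
  Input := S
  Index := X
  eval x F := F.1 x
  Xi F := spec (koopman F.1 (hS F.2))
  separates F G h := by
    by_contra! hFG
    obtain rfl : F = G := Subtype.ext (ContinuousMap.ext hFG)
    exact h rfl

variable (p ω) [IsFiniteMeasure ω] [NeZero ω]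

/-- `{Ξ_{σ_ap,ε}, Ω_X, M_H, Λ}^{Δ₁}` -/
noncomputable def apEpsGeneral (ε : ℝ) (hε : 0 < ε) : CompProblem (NonemptyCompacts ℂ) X :=
  (koopmanProblem (sigmaApEpsCompact ε hε) (generalClass p ω) subset_rfl).delta1

/-- `{Ξ_{σ_ap,ε}, Ω_X^m, M_H, Λ}^{Δ₁}` -/
noncomputable def apEpsMeasurePreserving (ε : ℝ) (hε : 0 < ε) :
    CompProblem (NonemptyCompacts ℂ) X :=
  (koopmanProblem (sigmaApEpsCompact ε hε) (measurePreservingClass ω)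
    (measurePreservingClass_subset p ω)).delta1

/-- `{Ξ_{σ_ap}, Ω_X, M_H, Λ}^{Δ₁}` -/
noncomputable def apGeneral : CompProblem (NonemptyCompacts ℂ) X :=
  (koopmanProblem (p := p) (ω := ω) sigmaApCompact (generalClass p ω) subset_rfl).delta1

/-- `{Ξ_{σ_ap}, Ω_X^m, M_H, Λ}^{Δ₁}` -/
noncomputable def apMeasurePreserving : CompProblem (NonemptyCompacts ℂ) X :=
  (koopmanProblem (p := p) (ω := ω) sigmaApCompact (measurePreservingClass ω)
    (measurePreservingClass_subset p ω)).delta1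

end Koopman

/-! Upper bounds. Continuous functions are dense in `L^p` for `p < ∞`, so the pseudospectrum is the
closure of the points `z` in a dense sequence of pairs `(z, f)` with `‖K f - z f‖ < ε ‖f‖`. The norm
is a limit of integrals over finite samples, each reading finitely many table entries
(`tendsto_sampledNorm`). The strict inequality says that for some `N` all samples from stage `N` on
stay below the bound by a margin; with `N` made part of the index, the pseudospectrum is the closure
of the points whose index is never refuted. The inner limit discards refuted indices and the outer
limit admits more of them, so the pseudospectrum is approximated from inside
(`exists_isInnerTower`). The approximate point spectrum is the decreasing intersection of the
pseudospectra for `ε = 1/(n+1)`, which costs one more limit, from outside.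

Lower bounds. Identify the Cantor set with `(ℕ → Bool) × (ℕ × ℕ → Bool)` and split the first factor,
up to one point, into clopen cells. Over the `m`-th cell a skew product either rotates the circle by
`4^{-(m+1)}`, so that `i` is an eigenvalue of the Koopman operator, or also flips one far coordinate
and rotates by an angle odd under the flip, so that it is an involution there. On finitely many
points the second behaviour imitates the first (`exists_skew_update_approx`). If all cells are of
the second kind, `K² = 1` keeps the spectral sets away from `i`, respectively `(1+ε)i`. Thus "some
cell is of the first kind" has to be decided: finite information defeats `Σ₁` (`not_inSigma_one`),
and Baire's theorem in the space of parameters and tables defeats `Π₂` (`not_inPi_two`). -/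

/-! ### Towers over closures of co-enumerable sets -/

namespace CompProblem

variable {M V : Type*}

/-- The map `g` depends only on finitely many evaluations, the same for all inputs. -/
def FinitelyDetermined {β : Type*} (P : CompProblem M V) (g : P.Input → β) : Prop :=
  ∃ Q : Finset P.Index, ∀ A B, (∀ i ∈ Q, P.eval i A = P.eval i B) → g A = g B

theorem FinitelyDetermined.isGeneralAlgorithm {P : CompProblem M V} [Nonempty P.Index]
    {Γ : P.Input → M} (h : P.FinitelyDetermined Γ) : P.IsGeneralAlgorithm Γ := by
  classical
  obtain ⟨Q, hQ⟩ := h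
  obtain ⟨i₀⟩ := ‹Nonempty P.Index›
  exact ⟨fun _ => insert i₀ Q, fun A => ⟨Finset.insert_nonempty _ _, fun B hB =>
    ⟨rfl, hQ A B fun i hi => hB i (Finset.mem_insert_of_mem hi)⟩⟩⟩

/-- A map computed from finitely many finitely determined properties is finitely determined. -/
theorem FinitelyDetermined.of_family {β ι : Type*} {P : CompProblem M V} {g : P.Input → β}
    (s : Finset ι) (c : ι → P.Input → Prop) (hc : ∀ i, P.FinitelyDetermined (c i))
    (hg : ∀ A B, (∀ i ∈ s, (c i A ↔ c i B)) → g A = g B) : P.FinitelyDetermined g := by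
  classical
  choose Q hQ using hc
  refine ⟨s.biUnion Q, fun A B h => hg A B fun i hi => ?_⟩
  rw [hQ i A B fun k hk => h k (Finset.mem_biUnion.2 ⟨i, hi, hk⟩)]

end CompProblem

section FiniteStages

open Classical in
/-- The set of the points `ζ j`, `j ∈ J`, if `J` is finite and non-empty, and `{0}` otherwise. -/
noncomputable def finiteHull (ζ : ℕ → ℂ) (J : Set ℕ) : NonemptyCompacts ℂ :=
  if h : J.Finite ∧ J.Nonempty then ⟨⟨ζ '' J, (h.1.image ζ).isCompact⟩, h.2.image ζ⟩ else {0}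

theorem coe_finiteHull {ζ : ℕ → ℂ} {J : Set ℕ} (h : J.Finite) (h' : J.Nonempty) :
    (finiteHull ζ J : Set ℂ) = ζ '' J := by
  rw [finiteHull, dif_pos ⟨h, h'⟩]
  rfl

/-- The indices accepted at stage `(m, n)`: those up to `m` that are not yet refuted, and the
least index that is not yet refuted. -/
def stageIndices (c : ℕ → ℕ → Prop) (m n : ℕ) : Set ℕ :=
  {j | j ≤ max m n ∧ (∀ k ≤ n, c j k) ∧ (j ≤ m ∨ ∀ i < j, ¬ ∀ k ≤ n, c i k)}

/-- The limit of `stageIndices c m n` as `n → ∞`. -/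
def limitIndices (c : ℕ → ℕ → Prop) (m : ℕ) : Set ℕ :=
  {j | (∀ k, c j k) ∧ (j ≤ m ∨ ∀ i < j, ¬ ∀ k, c i k)}

theorem finite_limitIndices {c : ℕ → ℕ → Prop} {j₀ : ℕ} (h : ∀ k, c j₀ k) (m : ℕ) :
    (limitIndices c m).Finite := by
  refine (Set.finite_Iic (max m j₀)).subset fun j hj => ?_
  rcases hj.2 with hj | hj
  · exact le_max_of_le_left hj
  · exact le_max_of_le_right (not_lt.1 fun hlt => hj j₀ hlt h)

theorem nonempty_limitIndices {c : ℕ → ℕ → Prop} {j₀ : ℕ} (h : ∀ k, c j₀ k) (m : ℕ) :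
    (limitIndices c m).Nonempty := by
  classical
  have hex : ∃ j, ∀ k, c j k := ⟨j₀, h⟩
  exact ⟨Nat.find hex, Nat.find_spec hex, Or.inr fun i hi => Nat.find_min hex hi⟩

/-- Since `j₀` is never refuted, no index beyond `max m j₀` is ever accepted, and the verdict on
each of the finitely many others is final from some stage on. -/
theorem eventually_stageIndices_eq {c : ℕ → ℕ → Prop} {j₀ : ℕ} (h : ∀ k, c j₀ k) (m : ℕ) :
    ∀ᶠ n in atTop, stageIndices c m n = limitIndices c m := by
  have key : ∀ j, ∀ᶠ n in atTop, (∀ k ≤ n, c j k) ↔ ∀ k, c j k := by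
    intro j
    by_cases hj : ∀ k, c j k
    · exact Eventually.of_forall fun n => ⟨fun _ => hj, fun _ k _ => hj k⟩
    · obtain ⟨k, hk⟩ := not_forall.1 hj
      filter_upwards [eventually_ge_atTop k] with n hn
      exact ⟨fun H => (hk (H k hn)).elim, fun H => (hj H).elim⟩
  have hall : ∀ᶠ n in atTop, ∀ j ∈ Finset.range (max m j₀ + 1),
      (∀ k ≤ n, c j k) ↔ ∀ k, c j k := (Finset.eventually_all _).2 fun j _ => key j
  filter_upwards [hall, eventually_ge_atTop j₀] with n hn hn₀
  have hn' : ∀ j ≤ max m j₀, ((∀ k ≤ n, c j k) ↔ ∀ k, c j k) := fun j hj =>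
    hn j (Finset.mem_range.2 (Nat.lt_succ_of_le hj))
  ext j
  constructor
  · rintro ⟨-, h1, h2⟩
    have hj : j ≤ max m j₀ := by
      rcases h2 with h2 | h2
      · exact le_max_of_le_left h2
      · exact le_max_of_le_right (not_lt.1 fun hlt => h2 j₀ hlt fun k _ => h k)
    refine ⟨(hn' j hj).1 h1, h2.imp_right fun h2 i hi => ?_⟩
    rw [← hn' i (hi.le.trans hj)]
    exact h2 i hi
  · rintro ⟨h1, h2⟩
    have hj : j ≤ max m j₀ := by
      rcases h2 with h2 | h2
      · exact le_max_of_le_left h2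
      · exact le_max_of_le_right (not_lt.1 fun hlt => h2 j₀ hlt h)
    refine ⟨hj.trans (max_le_max le_rfl hn₀), (hn' j hj).2 h1, h2.imp_right fun h2 i hi => ?_⟩
    rw [hn' i (hi.le.trans hj)]
    exact h2 i hi

/-- By compactness finitely many balls around accepted points cover `K`; once `m` exceeds their
indices, all their centres are present. -/
theorem tendsto_finiteHull_limitIndices {ζ : ℕ → ℂ} {c : ℕ → ℕ → Prop} {K : NonemptyCompacts ℂ}
    (hK : (K : Set ℂ) = closure (ζ '' {j | ∀ k, c j k})) :
    (∀ m, (finiteHull ζ (limitIndices c m) : Set ℂ) ⊆ K) ∧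
      Tendsto (fun m => finiteHull ζ (limitIndices c m)) atTop (𝓝 K) := by
  obtain ⟨-, j₀, hj₀, -⟩ : (ζ '' {j | ∀ k, c j k}).Nonempty := by
    rw [← closure_nonempty_iff, ← hK]
    exact K.nonempty
  have hco : ∀ m, (finiteHull ζ (limitIndices c m) : Set ℂ) = ζ '' limitIndices c m := fun m =>
    coe_finiteHull (finite_limitIndices hj₀ m) (nonempty_limitIndices hj₀ m)
  have hsub : ∀ m, (finiteHull ζ (limitIndices c m) : Set ℂ) ⊆ K := fun m => by
    rw [hco, hK]
    exact (Set.image_mono fun j hj => hj.1).trans subset_closure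
  refine ⟨hsub, Metric.tendsto_atTop.2 fun δ hδ => ?_⟩
  obtain ⟨t, ht⟩ := K.isCompact.elim_finite_subcover
    (fun j : {j | ∀ k, c j k} => Metric.ball (ζ j) (δ / 2)) (fun _ => Metric.isOpen_ball) (by
      rw [hK]
      intro z hz
      obtain ⟨-, ⟨j, hj, rfl⟩, hd⟩ := Metric.mem_closure_iff.1 hz (δ / 2) (by positivity)
      exact Set.mem_iUnion.2 ⟨⟨j, hj⟩, hd⟩)
  refine ⟨t.sup Subtype.val, fun m hm => ?_⟩
  refine lt_of_le_of_lt ?_ (half_lt_self hδ)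
  rw [Metric.NonemptyCompacts.dist_eq]
  refine Metric.hausdorffDist_le_of_mem_dist (by positivity)
    (fun z hz => ⟨z, hsub m hz, by rw [dist_self]; positivity⟩) fun z hz => ?_
  obtain ⟨j, hjt, hj⟩ := Set.mem_iUnion₂.1 (ht hz)
  refine ⟨ζ j, ?_, le_of_lt hj⟩
  rw [hco]
  exact ⟨j, ⟨j.2, Or.inl ((Finset.le_sup (f := Subtype.val) hjt).trans hm)⟩, rfl⟩

theorem tendsto_finiteHull_stageIndices {ζ : ℕ → ℂ} {c : ℕ → ℕ → Prop} {j₀ : ℕ}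
    (h : ∀ k, c j₀ k) (m : ℕ) :
    Tendsto (fun n => finiteHull ζ (stageIndices c m n)) atTop
      (𝓝 (finiteHull ζ (limitIndices c m))) := by
  refine tendsto_const_nhds.congr' ?_
  filter_upwards [eventually_stageIndices_eq h m] with n hn
  rw [hn]

end FiniteStages

namespace CompProblem

variable {V : Type*}

/-- `T m n` is a tower of height two for the function `ξ` that approximates it from inside. -/
structure IsInnerTower (P : CompProblem (NonemptyCompacts ℂ) V)
    (ξ : P.Input → NonemptyCompacts ℂ) (T : ℕ → ℕ → P.Input → NonemptyCompacts ℂ)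
    (L : ℕ → P.Input → NonemptyCompacts ℂ) : Prop where
  isGeneralAlgorithm : ∀ m n, P.IsGeneralAlgorithm (T m n)
  tendsto_inner : ∀ m A, Tendsto (fun n => T m n A) atTop (𝓝 (L m A))
  tendsto_outer : ∀ A, Tendsto (fun m => L m A) atTop (𝓝 (ξ A))
  subset : ∀ m A, (L m A : Set ℂ) ⊆ ξ A

theorem exists_isInnerTower (P : CompProblem (NonemptyCompacts ℂ) V) [Nonempty P.Index]
    {ξ : P.Input → NonemptyCompacts ℂ} (ζ : ℕ → ℂ) (c : ℕ → ℕ → P.Input → Prop)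
    (hc : ∀ j k, P.FinitelyDetermined (c j k))
    (hξ : ∀ A, (ξ A : Set ℂ) = closure (ζ '' {j | ∀ k, c j k A})) :
    ∃ T L, P.IsInnerTower ξ T L := by
  refine ⟨fun m n A => finiteHull ζ (stageIndices (fun j k => c j k A) m n),
    fun m A => finiteHull ζ (limitIndices (fun j k => c j k A) m), fun m n => ?_, fun m A => ?_,
    fun A => (tendsto_finiteHull_limitIndices (hξ A)).2,
    fun m A => (tendsto_finiteHull_limitIndices (hξ A)).1 m⟩
  · refine (FinitelyDetermined.of_family
      (Finset.range (max m n + 1) ×ˢ Finset.range (n + 1)) (fun i => c i.1 i.2)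
      (fun i => hc i.1 i.2) fun A B h => ?_).isGeneralAlgorithm
    congr 1
    have h1 : ∀ j ≤ max m n, ((∀ k ≤ n, c j k A) ↔ ∀ k ≤ n, c j k B) := fun j hj =>
      forall₂_congr fun k hk => h (j, k) (by
        simp only [Finset.mem_product, Finset.mem_range]; omega)
    ext j
    refine and_congr_right fun hj => and_congr (h1 j hj) (or_congr_right ?_)
    exact forall₂_congr fun i hi => not_congr (h1 i (hi.le.trans hj))
  · obtain ⟨-, j₀, hj₀, -⟩ : (ζ '' {j | ∀ k, c j k A}).Nonempty := by
      rw [← closure_nonempty_iff, ← hξ]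
      exact (ξ A).nonempty
    exact tendsto_finiteHull_stageIndices (c := fun j k => c j k A) hj₀ m

theorem IsInnerTower.inSigma {P : CompProblem (NonemptyCompacts ℂ) V} {T L}
    (h : P.IsInnerTower P.Xi T L) : P.InSigma 2 := by
  let Γ : List ℕ → P.Input → NonemptyCompacts ℂ := fun l =>
    match l with
    | [] => P.Xi
    | [m] => L m
    | m :: n :: _ => T m n
  have hΓ : P.IsTower 2 Γ := by
    refine ⟨fun l hl => ?_, fun l hl A => ?_, fun A => rfl⟩
    · match l, hl with
      | [m, n], _ => exact h.isGeneralAlgorithm m n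
    · match l, hl with
      | [], _ => exact h.tendsto_outer A
      | [m], _ => exact h.tendsto_inner m A
  -- The outer stages lie inside the value, so the value itself is the enclosing set, with error
  -- zero.
  refine ⟨⟨2, le_rfl, Γ, hΓ⟩, Γ, hΓ, fun _ => P.Xi, fun A => ⟨fun n => h.subset n A,
    h.tendsto_outer A, fun n => ?_⟩⟩
  rw [dist_self]
  positivity

theorem inPi_three_of_isInnerTower {P : CompProblem (NonemptyCompacts ℂ) V}
    {ξ : ℕ → P.Input → NonemptyCompacts ℂ} {T : ℕ → ℕ → ℕ → P.Input → NonemptyCompacts ℂ}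
    {L : ℕ → ℕ → P.Input → NonemptyCompacts ℂ} (h : ∀ s, P.IsInnerTower (ξ s) (T s) (L s))
    (hsub : ∀ s A, (P.Xi A : Set ℂ) ⊆ ξ s A)
    (hlim : ∀ A, Tendsto (fun s => ξ s A) atTop (𝓝 (P.Xi A))) : P.InPi 3 := by
  let Γ : List ℕ → P.Input → NonemptyCompacts ℂ := fun l =>
    match l with
    | [] => P.Xi
    | [s] => ξ s
    | [s, m] => L s m
    | s :: m :: n :: _ => T s m n
  have hΓ : P.IsTower 3 Γ := by
    refine ⟨fun l hl => ?_, fun l hl A => ?_, fun A => rfl⟩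
    · match l, hl with
      | [s, m, n], _ => exact (h s).isGeneralAlgorithm m n
    · match l, hl with
      | [], _ => exact hlim A
      | [s], _ => exact (h s).tendsto_outer A
      | [s, m], _ => exact (h s).tendsto_inner m A
  refine ⟨⟨3, le_rfl, Γ, hΓ⟩, Γ, hΓ, ξ, fun A => ⟨fun n => hsub n A, hlim A, fun n => ?_⟩⟩
  change dist (ξ n A) (ξ n A) ≤ _
  rw [dist_self]
  positivity

end CompProblem

/-- A decreasing sequence of compact sets converges to its intersection. -/
theorem tendsto_nonemptyCompacts_of_antitone {K : ℕ → NonemptyCompacts ℂ} {K₀ : NonemptyCompacts ℂ}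
    (hanti : Antitone fun n => (K n : Set ℂ)) (hK : (K₀ : Set ℂ) = ⋂ n, (K n : Set ℂ)) :
    Tendsto K atTop (𝓝 K₀) := by
  have hsub : ∀ n, (K₀ : Set ℂ) ⊆ K n := fun n => hK ▸ Set.iInter_subset _ n
  refine Metric.tendsto_atTop.2 fun δ hδ => ?_
  obtain ⟨N, hN⟩ := exists_subset_nhds_of_isCompact' (V := fun n => (K n : Set ℂ))
    hanti.directed_ge (fun n => (K n).isCompact) (fun n => (K n).isCompact.isClosed)
    (U := Metric.thickening (δ / 2) (K₀ : Set ℂ)) (fun z hz =>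
      Metric.isOpen_thickening.mem_nhds
        (Metric.self_subset_thickening (by positivity) _ (hK ▸ hz)))
  refine ⟨N, fun n hn => lt_of_le_of_lt ?_ (half_lt_self hδ)⟩
  rw [Metric.NonemptyCompacts.dist_eq]
  refine Metric.hausdorffDist_le_of_mem_dist (by positivity) (fun z hz => ?_)
    fun z hz => ⟨z, hsub n hz, by rw [dist_self]; positivity⟩
  obtain ⟨w, hw, hd⟩ := Metric.mem_thickening_iff.1 (hN (hanti hn hz))
  exact ⟨w, hw, hd.le⟩

/-! ### Spectral sets of bounded operators -/

section SpectralSets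

variable {E : Type*} [NormedAddCommGroup E] [NormedSpace ℂ E]

theorem sigmaAp_subset_sigmaApEps {ε : ℝ} (hε : 0 < ε) (T : E →L[ℂ] E) :
    sigmaAp T ⊆ sigmaApEps ε T := fun z hz =>
  subset_closure ((mem_sigmaAp_iff T z).1 hz ε hε)

theorem sigmaApEps_mono {ε ε' : ℝ} (h : ε ≤ ε') (T : E →L[ℂ] E) :
    sigmaApEps ε T ⊆ sigmaApEps ε' T :=
  closure_mono fun _ ⟨f, hf, hlt⟩ => ⟨f, hf, hlt.trans_le h⟩

/-- A vector that works for a nearby `w` works for `z`, with the residual enlarged by at most `|w -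
z|`; the closure is absorbed by the slack `δ - ε`. -/
theorem exists_norm_lt_of_mem_sigmaApEps {ε δ : ℝ} (h : ε < δ) {T : E →L[ℂ] E} {z : ℂ}
    (hz : z ∈ sigmaApEps ε T) : ∃ f : E, ‖f‖ = 1 ∧ ‖T f - z • f‖ < δ := by
  obtain ⟨w, ⟨f, hf, hlt⟩, hd⟩ := Metric.mem_closure_iff.1 hz (δ - ε) (sub_pos.2 h)
  refine ⟨f, hf, ?_⟩
  have h1 : T f - z • f = (T f - w • f) + (w - z) • f := by rw [sub_smul]; abel
  have h2 : ‖(w - z) • f‖ < δ - ε := by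
    rwa [norm_smul, hf, mul_one, ← dist_eq_norm, dist_comm]
  rw [h1]
  linarith [norm_add_le (T f - w • f) ((w - z) • f)]

theorem sigmaAp_eq_iInter (T : E →L[ℂ] E) :
    sigmaAp T = ⋂ n : ℕ, sigmaApEps (1 / ((n : ℝ) + 1)) T := by
  refine subset_antisymm (Set.subset_iInter fun n =>
    sigmaAp_subset_sigmaApEps (by positivity) T) fun z hz => ?_
  refine (mem_sigmaAp_iff T z).2 fun δ hδ => ?_
  obtain ⟨n, hn⟩ := exists_nat_one_div_lt hδ
  exact exists_norm_lt_of_mem_sigmaApEps hn (Set.mem_iInter.1 hz n)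

/-- The pseudospectrum is determined by a dense sequence of pairs of points and vectors. -/
theorem sigmaApEps_eq_closure (ε : ℝ) (T : E →L[ℂ] E) {q : ℕ → ℂ × E} (hq : DenseRange q) :
    sigmaApEps ε T =
      closure {z | ∃ i, (q i).1 = z ∧ ‖T (q i).2 - (q i).1 • (q i).2‖ < ε * ‖(q i).2‖} := by
  refine subset_antisymm (closure_minimal ?_ isClosed_closure) (closure_mono ?_)
  · rintro z ⟨f, hf, hlt⟩
    refine mem_closure_iff.2 fun U hU hz => ?_
    -- In homogeneous form the condition is open in the pair, so the dense sequence meets it without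
    -- being normalized.
    have hopen : IsOpen {w : ℂ × E | w.1 ∈ U ∧ ‖T w.2 - w.1 • w.2‖ < ε * ‖w.2‖} :=
      (hU.preimage continuous_fst).inter (isOpen_lt
        ((T.continuous.comp continuous_snd).sub (continuous_fst.smul continuous_snd)).norm
        (continuous_const.mul continuous_snd.norm))
    obtain ⟨i, hi⟩ := hq.exists_mem_open hopen ⟨(z, f), hz, by simpa [hf] using hlt⟩
    exact ⟨_, hi.1, i, rfl, hi.2⟩
  · rintro z ⟨i, rfl, hi⟩
    have hn : 0 < ‖(q i).2‖ := by
      refine norm_pos_iff.2 fun h0 => ?_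
      simp [h0] at hi
    refine ⟨((‖(q i).2‖⁻¹ : ℝ) : ℂ) • (q i).2, ?_, ?_⟩
    · rw [norm_smul, Complex.norm_real, norm_inv, norm_norm, inv_mul_cancel₀ hn.ne']
    · rw [map_smul, smul_comm (q i).1, ← smul_sub, norm_smul, Complex.norm_real, norm_inv,
        norm_norm, inv_mul_lt_iff₀ hn, mul_comm]
      exact hi

end SpectralSets

/-! ### Upper bounds -/

section UpperBounds

variable {X : Type*} [MetricSpace X] [MeasurableSpace X]

theorem exists_simpleFunc_tendsto_id (X : Type*) [MetricSpace X] [CompactSpace X]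
    [MeasurableSpace X] [BorelSpace X] [Nonempty X] :
    ∃ s : ℕ → SimpleFunc X X, ∀ x, Tendsto (fun n => s n x) atTop (𝓝 x) := by
  obtain ⟨x₀⟩ := ‹Nonempty X›
  exact ⟨SimpleFunc.approxOn id measurable_id Set.univ x₀ (Set.mem_univ _), fun x =>
    SimpleFunc.tendsto_approxOn measurable_id (Set.mem_univ x₀) (by simp)⟩

/-- The approximation, from the table `a` and the sampling `s n`, of the `p`-th power of the norm
of `f ∘ F - z • f`. -/
noncomputable def sampledNorm (p : ℝ≥0∞) (ω : Measure X) (s : ℕ → SimpleFunc X X) (f : C(X, ℂ))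
    (z : ℂ) (n : ℕ) (a : X × ℕ → X) : ℝ :=
  ∫ x, ‖f (a (s n x, n)) - z * f (s n x)‖ ^ p.toReal ∂ω

/-- The range of `s n` is finite, so only finitely many entries enter the integral. -/
theorem sampledNorm_congr (p : ℝ≥0∞) (ω : Measure X) {s : ℕ → SimpleFunc X X} (f : C(X, ℂ))
    (z : ℂ) {n : ℕ} {a b : X × ℕ → X} (h : ∀ y ∈ (s n).range, a (y, n) = b (y, n)) :
    sampledNorm p ω s f z n a = sampledNorm p ω s f z n b :=
  integral_congr_ae (Eventually.of_forall fun x => by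
    simp only [h (s n x) (SimpleFunc.mem_range_self _ x)])

variable [CompactSpace X] {p : ℝ≥0∞} {ω : Measure X} [IsFiniteMeasure ω]

/-- Dominated convergence with a constant bound: `a (s n x, n)` is within `2⁻ⁿ` of `F (s n x)`,
which tends to `F x` by continuity. -/
theorem tendsto_sampledNorm {s : ℕ → SimpleFunc X X}
    (hs : ∀ x, Tendsto (fun n => s n x) atTop (𝓝 x)) (f : C(X, ℂ)) (z : ℂ) {a : X × ℕ → X}
    {F : C(X, X)} (ha : ∀ x n, dist (a (x, n)) (F x) ≤ (2 : ℝ)⁻¹ ^ n) :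
    Tendsto (fun n => sampledNorm p ω s f z n a) atTop
      (𝓝 (∫ x, ‖f (F x) - z * f x‖ ^ p.toReal ∂ω)) := by
  refine tendsto_integral_of_dominated_convergence
    (fun _ => (‖f‖ + ‖z‖ * ‖f‖) ^ p.toReal) (fun n => ?_) (integrable_const _)
    (fun n => Eventually.of_forall fun x => ?_) (Eventually.of_forall fun x => ?_)
  · exact ((s n).map fun y => ‖f (a (y, n)) - z * f y‖ ^ p.toReal).aestronglyMeasurable
  · rw [Real.norm_of_nonneg (by positivity)]
    refine Real.rpow_le_rpow (norm_nonneg _) ?_ ENNReal.toReal_nonneg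
    refine (norm_sub_le _ _).trans (add_le_add (f.norm_coe_le_norm _) ?_)
    rw [norm_mul]
    gcongr
    exact f.norm_coe_le_norm _
  · have h0 : Tendsto (fun n : ℕ => (2 : ℝ)⁻¹ ^ n) atTop (𝓝 0) :=
      tendsto_pow_atTop_nhds_zero_of_lt_one (by norm_num) (by norm_num)
    have h1 : Tendsto (fun n => F (s n x)) atTop (𝓝 (F x)) := (F.continuous.tendsto x).comp (hs x)
    have h2 : Tendsto (fun n => a (s n x, n)) atTop (𝓝 (F x)) := by
      refine tendsto_iff_dist_tendsto_zero.2 (squeeze_zero (fun _ => dist_nonneg)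
        (fun n => (dist_triangle _ (F (s n x)) _).trans (add_le_add_left (ha _ n) _)) ?_)
      simpa using h0.add (tendsto_iff_dist_tendsto_zero.1 h1)
    have h3 : Tendsto (fun n => ‖f (a (s n x, n)) - z * f (s n x)‖) atTop
        (𝓝 ‖f (F x) - z * f x‖) :=
      (((f.continuous.tendsto _).comp h2).sub
        (tendsto_const_nhds.mul ((f.continuous.tendsto _).comp (hs x)))).norm
    exact h3.rpow_const (Or.inr ENNReal.toReal_nonneg)

variable [BorelSpace X] [Fact (1 ≤ p)]

theorem norm_koopman_sub_smul_rpow (hp : p ≠ ∞) {F : C(X, X)} (hF : F ∈ generalClass p ω)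
    (f : C(X, ℂ)) (z : ℂ) :
    ‖koopman F hF (ContinuousMap.toLp p ω ℂ f) - z • ContinuousMap.toLp p ω ℂ f‖ ^ p.toReal =
      ∫ x, ‖f (F x) - z * f x‖ ^ p.toReal ∂ω := by
  have hp1 : 1 ≤ p := Fact.out
  have hp0 : p ≠ 0 := (zero_lt_one.trans_le hp1).ne'
  have hpr : 0 < p.toReal := ENNReal.toReal_pos hp0 hp
  set g := koopman F hF (ContinuousMap.toLp p ω ℂ f) - z • ContinuousMap.toLp p ω ℂ f with hg
  have hae : ∀ᵐ x ∂ω, g x = f (F x) - z * f x := by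
    have h1 := ContinuousMap.coeFn_toLp (p := p) (𝕜 := ℂ) ω f
    have h2 := (quasiMeasurePreserving_of_mem hF).ae_eq_comp h1
    filter_upwards [h1, h2, koopman_coeFn F hF (ContinuousMap.toLp p ω ℂ f),
      Lp.coeFn_sub (koopman F hF (ContinuousMap.toLp p ω ℂ f)) (z • ContinuousMap.toLp p ω ℂ f),
      Lp.coeFn_smul z (ContinuousMap.toLp p ω ℂ f)] with x h1 h2 h3 h4 h5
    rw [hg, h4, Pi.sub_apply, h5, Pi.smul_apply, h3, h1, h2, smul_eq_mul, Function.comp_apply]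
  have hint : 0 ≤ ∫ x, ‖g x‖ ^ p.toReal ∂ω := integral_nonneg fun x => by positivity
  rw [Lp.norm_def, (Lp.memLp g).eLpNorm_eq_integral_rpow_norm hp0 hp,
    ENNReal.toReal_ofReal (by positivity), ← Real.rpow_mul hint, inv_mul_cancel₀ hpr.ne',
    Real.rpow_one]
  refine integral_congr_ae ?_
  filter_upwards [hae] with x hx
  rw [hx]

variable [NeZero ω]

theorem exists_isInnerTower_sigmaApEps (hp : p ≠ ∞) {ε : ℝ} (hε : 0 < ε)
    (spec : (Lp ℂ p ω →L[ℂ] Lp ℂ p ω) → NonemptyCompacts ℂ) (S : Set C(X, X))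
    (hS : S ⊆ generalClass p ω) :
    ∃ T L, (koopmanProblem spec S hS).delta1.IsInnerTower
      (fun A => sigmaApEpsCompact ε hε (koopman A.2.choose.1 (hS A.2.choose.2))) T L := by
  have hX : Nonempty X := by
    by_contra h
    rw [not_nonempty_iff] at h
    exact NeZero.ne ω (Measure.eq_zero_of_isEmpty ω)
  have : Nonempty (koopmanProblem spec S hS).delta1.Index := ⟨(hX.some, 0)⟩
  have hp1 : 1 ≤ p := Fact.out
  have hpr : 0 < p.toReal := ENNReal.toReal_pos (zero_lt_one.trans_le hp1).ne' hp
  obtain ⟨s, hs⟩ := exists_simpleFunc_tendsto_id X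
  let q : ℕ → ℂ × C(X, ℂ) := denseSeq (ℂ × C(X, ℂ))
  let ι : ℂ × C(X, ℂ) → ℂ × Lp ℂ p ω := Prod.map id (ContinuousMap.toLp p ω ℂ)
  have hq : DenseRange fun i => ι (q i) :=
    (denseRange_id.prodMap (ContinuousMap.toLp_denseRange ℂ ω ℂ hp)).comp (denseRange_denseSeq _)
      (continuous_id.prodMap (ContinuousMap.toLp p ω ℂ).continuous)
  let bound : ℕ → ℝ := fun i => (ε * ‖ContinuousMap.toLp p ω ℂ (q i).2‖) ^ p.toReal
  -- The index `j` codes a pair `(i, N)`, where `N` is both the threshold from which stages are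
  -- tested and, through `1/(N+1)`, the margin. A limit is strictly below the bound exactly if some
  -- `N` passes all tests.
  refine CompProblem.exists_isInnerTower _ (fun j => (q j.unpair.1).1)
    (fun j k A => j.unpair.2 ≤ k → sampledNorm p ω s (q j.unpair.1).2 (q j.unpair.1).1 k A.1 ≤
      bound j.unpair.1 - 1 / ((j.unpair.2 : ℝ) + 1)) (fun j k => ?_) (fun A => ?_)
  · let Q : Finset (X × ℕ) := (s k).range ×ˢ {k}
    refine ⟨Q, fun A B h => ?_⟩
    simp only [sampledNorm_congr p ω (q j.unpair.1).2 (q j.unpair.1).1 (a := A.1) (b := B.1)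
      fun y hy => h (y, k) (Finset.mem_product.2 ⟨hy, Finset.mem_singleton_self k⟩)]
  · change sigmaApEps ε _ = _
    rw [sigmaApEps_eq_closure ε _ hq]
    congr 1
    set F := A.2.choose
    have hlim : ∀ i, Tendsto (fun n => sampledNorm p ω s (q i).2 (q i).1 n A.1) atTop
        (𝓝 (‖koopman F.1 (hS F.2) (ι (q i)).2 - (ι (q i)).1 • (ι (q i)).2‖ ^ p.toReal)) := by
      intro i
      have h1 := norm_koopman_sub_smul_rpow hp (hS F.2) (q i).2 (q i).1
      have h2 := tendsto_sampledNorm (p := p) (ω := ω) hs (q i).2 (q i).1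
        (fun x n => A.2.choose_spec x n)
      rw [← h1] at h2
      exact h2
    ext z
    constructor
    · rintro ⟨i, rfl, hi⟩
      have h1 : ‖koopman F.1 (hS F.2) (ι (q i)).2 - (ι (q i)).1 • (ι (q i)).2‖ ^ p.toReal
          < bound i := Real.rpow_lt_rpow (norm_nonneg _) hi hpr
      obtain ⟨m, hm⟩ := exists_between h1
      obtain ⟨N₁, hN₁⟩ := eventually_atTop.1 ((hlim i).eventually_lt_const hm.1)
      obtain ⟨N₂, hN₂⟩ := exists_nat_one_div_lt (sub_pos.2 hm.2)
      have hN : 1 / (((max N₁ N₂ : ℕ) : ℝ) + 1) ≤ 1 / ((N₂ : ℝ) + 1) :=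
        one_div_le_one_div_of_le (by positivity) (by
          gcongr
          exact le_max_right _ _)
      refine ⟨Nat.pair i (max N₁ N₂), fun k hk => ?_, by simp; rfl⟩
      simp only [Nat.unpair_pair] at hk ⊢
      have h3 := hN₁ k ((le_max_left _ _).trans hk)
      linarith
    · rintro ⟨j, hj, rfl⟩
      refine ⟨j.unpair.1, rfl, ?_⟩
      have h1 : ‖koopman F.1 (hS F.2) (ι (q j.unpair.1)).2 -
          (ι (q j.unpair.1)).1 • (ι (q j.unpair.1)).2‖ ^ p.toReal ≤
          bound j.unpair.1 - 1 / ((j.unpair.2 : ℝ) + 1) := by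
        refine le_of_tendsto (hlim j.unpair.1) ?_
        filter_upwards [eventually_ge_atTop j.unpair.2] with k hk using hj k hk
      have h2 : (0 : ℝ) < 1 / ((j.unpair.2 : ℝ) + 1) := by positivity
      exact (Real.rpow_lt_rpow_iff (norm_nonneg _)
        (mul_nonneg hε.le (norm_nonneg _)) hpr).1 (by
          change _ < bound j.unpair.1
          linarith)

theorem koopmanProblem_sigmaApEps_inSigma_two (hp : p ≠ ∞) {ε : ℝ} (hε : 0 < ε) (S : Set C(X, X))
    (hS : S ⊆ generalClass p ω) :
    (koopmanProblem (sigmaApEpsCompact ε hε) S hS).delta1.InSigma 2 := by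
  obtain ⟨T, L, h⟩ := exists_isInnerTower_sigmaApEps hp hε (sigmaApEpsCompact ε hε) S hS
  exact CompProblem.IsInnerTower.inSigma h

theorem koopmanProblem_sigmaAp_inPi_three (hp : p ≠ ∞) (S : Set C(X, X))
    (hS : S ⊆ generalClass p ω) :
    (koopmanProblem sigmaApCompact S hS).delta1.InPi 3 := by
  choose T L h using fun n : ℕ => exists_isInnerTower_sigmaApEps hp
    (show (0 : ℝ) < 1 / ((n : ℝ) + 1) by positivity) sigmaApCompact S hS
  refine CompProblem.inPi_three_of_isInnerTower h (fun n A =>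
    sigmaAp_subset_sigmaApEps (by positivity) _) fun A =>
    tendsto_nonemptyCompacts_of_antitone (fun m n hmn => sigmaApEps_mono ?_ _)
      (sigmaAp_eq_iInter _)
  exact one_div_le_one_div_of_le (by positivity) (by gcongr)

end UpperBounds

/-! ### Adversarial families -/

namespace CompProblem

variable {V : Type*} [MetricSpace V]

/-- A family of inputs of `P` with parameters in `ℕ → Option I`, each evaluation of which depends
on one coordinate of the parameter. The point `z₀` belongs to the value if some coordinate is
`none`, the value is a subset of `N` if there is no such coordinate, and any coordinate `none` can
be changed so that finitely many evaluations vary arbitrarily little. -/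
structure AdversarialFamily (P : CompProblem (NonemptyCompacts ℂ) V) (I : Type*) (z₀ : ℂ)
    (N : Set ℂ) where
  /-- the family -/
  input : (ℕ → Option I) → P.Input
  /-- the coordinate on which an evaluation depends -/
  coord : P.Index → ℕ
  eval_congr : ∀ i s t, s (coord i) = t (coord i) → P.eval i (input s) = P.eval i (input t)
  mem_of_none : ∀ s m, s m = none → z₀ ∈ (P.Xi (input s) : Set ℂ)
  subset_of_some : ∀ s : ℕ → I, (P.Xi (input fun m => some (s m)) : Set ℂ) ⊆ N
  exists_approx : ∀ s m, s m = none → ∀ (E : Finset P.Index) (η : ℝ), 0 < η →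
    ∃ i, ∀ x ∈ E,
      dist (P.eval x (input s)) (P.eval x (input (Function.update s m (some i)))) ≤ η

theorem IsGeneralAlgorithm.exists_entries {M : Type*} {P : CompProblem M V}
    {Γ : P.delta1.Input → M} (h : P.delta1.IsGeneralAlgorithm Γ) :
    ∃ Q : P.delta1.Input → Finset (P.Index × ℕ),
      ∀ A B : P.delta1.Input, (∀ x ∈ Q A, A.1 x = B.1 x) → Γ A = Γ B := by
  obtain ⟨Q, hQ⟩ := h
  exact ⟨Q, fun A B hAB => ((hQ A).2 B hAB).2⟩

namespace AdversarialFamily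

variable {P : CompProblem (NonemptyCompacts ℂ) V} {I : Type*} {z₀ : ℂ} {N : Set ℂ}

theorem exists_approx_table (φ : P.AdversarialFamily I z₀ N) {s : ℕ → Option I} {m : ℕ}
    (hs : s m = none) (E : Finset (P.Index × ℕ)) :
    ∃ i, ∀ x ∈ E, dist (P.eval x.1 (φ.input s))
      (P.eval x.1 (φ.input (Function.update s m (some i)))) ≤ (2 : ℝ)⁻¹ ^ x.2 := by
  classical
  obtain ⟨i, hi⟩ := φ.exists_approx s m hs (E.image Prod.fst) ((2 : ℝ)⁻¹ ^ E.sup Prod.snd)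
    (by positivity)
  exact ⟨i, fun x hx => (hi x.1 (Finset.mem_image_of_mem _ hx)).trans
    (pow_le_pow_of_le_one (by norm_num) (by norm_num) (Finset.le_sup (f := Prod.snd) hx))⟩

theorem infDist_le_add_dist (z : ℂ) (K L : NonemptyCompacts ℂ) :
    Metric.infDist z (K : Set ℂ) ≤ Metric.infDist z (L : Set ℂ) + dist K L := by
  have h := (Metric.lipschitz_infDist_set z).dist_le_mul K L
  rw [NNReal.coe_one, one_mul, Real.dist_eq] at h
  linarith [le_abs_self (Metric.infDist z (K : Set ℂ) - Metric.infDist z (L : Set ℂ))]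

theorem tendsto_infDist (z : ℂ) {K : ℕ → NonemptyCompacts ℂ} {L : NonemptyCompacts ℂ}
    (h : Tendsto K atTop (𝓝 L)) :
    Tendsto (fun n => Metric.infDist z (K n : Set ℂ)) atTop (𝓝 (Metric.infDist z (L : Set ℂ))) :=
  ((Metric.lipschitz_infDist_set z).continuous.tendsto L).comp h

theorem exists_le_infDist (hN : IsClosed N) (hz₀ : z₀ ∉ N) :
    ∃ δ > 0, ∀ K : NonemptyCompacts ℂ, (K : Set ℂ) ⊆ N → δ ≤ Metric.infDist z₀ (K : Set ℂ) := by
  obtain ⟨δ, hδ, hb⟩ := Metric.isOpen_iff.1 hN.isOpen_compl z₀ hz₀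
  refine ⟨δ, hδ, fun K hK => (Metric.le_infDist K.nonempty).2 fun w hw => ?_⟩
  by_contra! h
  exact hb (Metric.mem_ball'.2 h) (hK hw)

/-- A stage that is close to the value at an input with one `none` reads finitely many entries, so
it gives the same output at some input without `none`. There the `Σ₁` bound forces the output to
stay near `N`, away from `z₀`. -/
theorem not_inSigma_one [Nonempty I] (φ : P.AdversarialFamily I z₀ N) (hN : IsClosed N)
    (hz₀ : z₀ ∉ N) : ¬ P.delta1.InSigma 1 := by
  classical
  rintro ⟨-, Γ, hΓ, X, hX⟩
  obtain ⟨δ, hδ, hfar⟩ := exists_le_infDist hN hz₀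
  obtain ⟨i₀⟩ := ‹Nonempty I›
  let s : ℕ → Option I := Function.update (fun _ => some i₀) 0 none
  have hs : s 0 = none := Function.update_self _ _ _
  have hA' : P.IsDelta1Info (fun x => P.eval x.1 (φ.input s)) (φ.input s) := fun i n => by
    rw [dist_self]; positivity
  let A : P.delta1.Input := ⟨fun x => P.eval x.1 (φ.input s), φ.input s, hA'⟩
  have hzA : z₀ ∈ (P.delta1.Xi A : Set ℂ) := by
    rw [P.delta1_xi A hA']
    exact φ.mem_of_none s 0 hs
  have h1 := tendsto_infDist z₀ (hX A).2.1
  rw [Metric.infDist_zero_of_mem hzA] at h1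
  have h2 : Tendsto (fun n : ℕ => (2 : ℝ)⁻¹ ^ n) atTop (𝓝 0) :=
    tendsto_pow_atTop_nhds_zero_of_lt_one (by norm_num) (by norm_num)
  obtain ⟨n, hn1, hn2⟩ := ((h1.eventually_lt_const (half_pos hδ)).and
    (h2.eventually_lt_const (half_pos hδ))).exists
  obtain ⟨Q, hQ⟩ := (hΓ.base [n] rfl).exists_entries
  obtain ⟨i, hi⟩ := φ.exists_approx_table hs (Q A)
  let t : ℕ → I := Function.update (fun _ => i₀) 0 i
  have ht : (fun m => some (t m)) = Function.update s 0 (some i) := by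
    funext m
    rcases eq_or_ne m 0 with rfl | hm
    · simp [t]
    · simp [t, s, hm]
  -- The entries read at `A` are copied; by the choice of `i` they are still admissible for the new
  -- input.
  have hB' : P.IsDelta1Info (fun x => if x ∈ Q A then P.eval x.1 (φ.input s) else
      P.eval x.1 (φ.input fun m => some (t m))) (φ.input fun m => some (t m)) := fun j k => by
    by_cases hx : (j, k) ∈ Q A
    · simp only [hx, if_true, ht]
      exact hi _ hx
    · simp only [hx, if_false, dist_self]
      positivity
  let B : P.delta1.Input := ⟨_, _, hB'⟩
  have hAB : Γ [n] A = Γ [n] B := hQ A B fun x hx => by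
    simp only [A, B, if_pos hx]
  have hBN : (P.delta1.Xi B : Set ℂ) ⊆ N := by
    rw [P.delta1_xi B hB']
    exact φ.subset_of_some t
  have h3 := hfar _ hBN
  have h4 := infDist_le_add_dist z₀ (P.delta1.Xi B) (X n B)
  have h5 := Metric.infDist_le_infDist_of_subset (x := z₀) ((hX B).1 n) (Γ [n] B).nonempty
  have h6 := (hX B).2.2 n
  rw [dist_comm] at h6
  rw [← hAB] at h5
  linarith

/-! ### Baire category in the space of parameters and tables -/

section Baire

variable (φ : P.AdversarialFamily I z₀ N)

open Classical in
/-- The table given by the second components of `w` as far as these are admissible. -/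
noncomputable def table (w : ℕ → I × (P.Index × ℕ → V)) (x : P.Index × ℕ) : V :=
  -- Inadmissible proposals are replaced by exact values, so that every `w` yields a valid table.
  if dist ((w (φ.coord x.1)).2 x) (P.eval x.1 (φ.input fun m => some (w m).1)) ≤ (2 : ℝ)⁻¹ ^ x.2
  then (w (φ.coord x.1)).2 x else P.eval x.1 (φ.input fun m => some (w m).1)

theorem isDelta1Info_table (w : ℕ → I × (P.Index × ℕ → V)) :
    P.IsDelta1Info (φ.table w) (φ.input fun m => some (w m).1) := fun i n => by
  rw [table]
  split_ifs with h
  · exact h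
  · rw [dist_self]; positivity

theorem table_congr {w w' : ℕ → I × (P.Index × ℕ → V)} {x : P.Index × ℕ}
    (h : w (φ.coord x.1) = w' (φ.coord x.1)) : φ.table w x = φ.table w' x := by
  rw [table, table, h, φ.eval_congr x.1 (fun m => some (w m).1) (fun m => some (w' m).1)
    (by simp only [h])]

/-- The input with the table `φ.table w`. -/
noncomputable def tableInput (w : ℕ → I × (P.Index × ℕ → V)) : P.delta1.Input :=
  ⟨φ.table w, _, φ.isDelta1Info_table w⟩

/-- Finitely many entries are read, and each depends on one coordinate of `w`, which ranges over a
discrete space. -/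
theorem isOpen_setOf_tableInput [TopologicalSpace (I × (P.Index × ℕ → V))]
    [DiscreteTopology (I × (P.Index × ℕ → V))] {Γ : P.delta1.Input → NonemptyCompacts ℂ}
    (hΓ : P.delta1.IsGeneralAlgorithm Γ) (S : Set (NonemptyCompacts ℂ)) :
    IsOpen {w | Γ (φ.tableInput w) ∈ S} := by
  obtain ⟨Q, hQ⟩ := hΓ.exists_entries
  refine isOpen_iff_mem_nhds.2 fun w hw => ?_
  have : ∀ᶠ w' in 𝓝 w, ∀ x ∈ Q (φ.tableInput w), w (φ.coord x.1) = w' (φ.coord x.1) := by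
    refine (Finset.eventually_all _).2 fun x _ => ?_
    have hmem := ((isOpen_discrete {w (φ.coord x.1)}).preimage
      (continuous_apply (A := fun _ : ℕ => I × (P.Index × ℕ → V)) (φ.coord x.1))).mem_nhds
        (x := w) rfl
    filter_upwards [hmem] with w' hw' using Eq.symm hw'
  filter_upwards [this] with w' hw'
  rw [← hQ (φ.tableInput w) (φ.tableInput w') fun x hx => φ.table_congr (hw' x hx)]
  exact hw

/-- With `none` at `m` the value contains `z₀`, so some `Γ k` lands in `S` after reading finitely
many entries; a suitable `some i` with the same entries is then indistinguishable. -/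
theorem exists_update_tableInput_mem {Γ : ℕ → P.delta1.Input → NonemptyCompacts ℂ}
    (hΓ : ∀ k, P.delta1.IsGeneralAlgorithm (Γ k)) {S : Set (NonemptyCompacts ℂ)}
    (hS : ∀ A, z₀ ∈ (P.delta1.Xi A : Set ℂ) → ∃ k, Γ k A ∈ S)
    (w : ℕ → I × (P.Index × ℕ → V)) (m : ℕ) :
    ∃ j k, Γ k (φ.tableInput (Function.update w m j)) ∈ S := by
  classical
  let s : ℕ → Option I := Function.update (fun m => some (w m).1) m none
  have hs : s m = none := Function.update_self _ _ _
  have hA' : P.IsDelta1Info (fun x => if φ.coord x.1 = m then P.eval x.1 (φ.input s) else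
      φ.table w x) (φ.input s) := fun i n => by
    by_cases hi : φ.coord i = m
    · simp only [hi, if_true, dist_self]
      positivity
    · simp only [hi, if_false]
      rw [φ.eval_congr i s (fun m => some (w m).1) (Function.update_of_ne hi _ _)]
      exact φ.isDelta1Info_table w i n
  let A : P.delta1.Input := ⟨_, _, hA'⟩
  obtain ⟨k, hk⟩ := hS A (by
    rw [P.delta1_xi A hA']
    exact φ.mem_of_none s m hs)
  obtain ⟨Q, hQ⟩ := (hΓ k).exists_entries
  obtain ⟨i, hi⟩ := φ.exists_approx_table hs (Q A)
  -- The second component preserves the values of the input with `none`; `table` accepts them at the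
  -- entries read.
  refine ⟨(i, fun x => P.eval x.1 (φ.input s)), k, ?_⟩
  set w' := Function.update w m (i, fun x => P.eval x.1 (φ.input s)) with hw'
  have hws : (fun n => some (w' n).1) = Function.update s m (some i) := by
    funext n
    rcases eq_or_ne n m with rfl | hn
    · simp [w']
    · simp [w', s, hn]
  rw [← hQ A (φ.tableInput w') fun x hx => ?_]
  · exact hk
  change (if φ.coord x.1 = m then P.eval x.1 (φ.input s) else φ.table w x) = φ.table w' x
  by_cases hx' : φ.coord x.1 = m
  · rw [if_pos hx', table, hws, hx', hw', Function.update_self, if_pos (hi x hx)]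
  · rw [if_neg hx']
    exact φ.table_congr (Function.update_of_ne hx' _ _).symm

/-- Changing only coordinate `m` gives points that converge to `w` as `m → ∞`. -/
theorem dense_setOf_tableInput [TopologicalSpace (I × (P.Index × ℕ → V))]
    {Γ : ℕ → P.delta1.Input → NonemptyCompacts ℂ}
    (hΓ : ∀ k, P.delta1.IsGeneralAlgorithm (Γ k)) {S : Set (NonemptyCompacts ℂ)}
    (hS : ∀ A, z₀ ∈ (P.delta1.Xi A : Set ℂ) → ∃ k, Γ k A ∈ S) :
    Dense {w | ∃ k, Γ k (φ.tableInput w) ∈ S} := by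
  classical
  intro w
  choose j hj using φ.exists_update_tableInput_mem hΓ hS w
  refine mem_closure_of_tendsto (f := fun m => Function.update w m (j m)) (b := atTop)
    (tendsto_pi_nhds.2 fun n => ?_) (Eventually.of_forall hj)
  refine tendsto_const_nhds.congr' ?_
  filter_upwards [eventually_gt_atTop n] with m hm
  rw [Function.update_of_ne hm.ne]

end Baire

/-- For `n ≥ n₀` the `Π₂` bound puts `Γ_n` near `z₀` whenever some coordinate is `none`. Hence a
generic `w`, although it has no `none`, makes `Γ_{n,k}` come near `z₀` for arbitrarily large `k`.
Both limits inherit this, whereas the value lies in `N`. -/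
theorem not_inPi_two [Nonempty I] (φ : P.AdversarialFamily I z₀ N) (hN : IsClosed N)
    (hz₀ : z₀ ∉ N) : ¬ P.delta1.InPi 2 := by
  rintro ⟨-, Γ, hΓ, X, hX⟩
  obtain ⟨δ, hδ, hfar⟩ := exists_le_infDist hN hz₀
  obtain ⟨i₀⟩ := ‹Nonempty I›
  have h2 : Tendsto (fun n : ℕ => (2 : ℝ)⁻¹ ^ n) atTop (𝓝 0) :=
    tendsto_pow_atTop_nhds_zero_of_lt_one (by norm_num) (by norm_num)
  obtain ⟨n₀, hn₀⟩ := eventually_atTop.1 (h2.eventually_lt_const (half_pos hδ))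
  let J := I × (P.Index × ℕ → V)
  let : TopologicalSpace J := ⊥
  have : DiscreteTopology J := ⟨rfl⟩
  have : Nonempty J := ⟨(i₀, fun x => P.eval x.1 (φ.input fun _ => none))⟩
  let S : Set (NonemptyCompacts ℂ) := {K | Metric.infDist z₀ (K : Set ℂ) < δ / 2}
  -- The offset `q.2` turns membership in all `G q` into "for infinitely many `k`".
  let G : ℕ × ℕ → Set (ℕ → J) := fun q =>
    {w | ∃ k, Γ [n₀ + q.1, q.2 + k] (φ.tableInput w) ∈ S}
  have hGA : ∀ n k, P.delta1.IsGeneralAlgorithm (Γ [n, k]) := fun n k => hΓ.base [n, k] rfl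
  have hlim : ∀ n A, Tendsto (fun k => Metric.infDist z₀ (Γ [n, k] A : Set ℂ)) atTop
      (𝓝 (Metric.infDist z₀ (Γ [n] A : Set ℂ))) := fun n A =>
    tendsto_infDist z₀ (hΓ.lim [n] (by simp) A)
  have hopen : ∀ q, IsOpen (G q) := fun q => by
    have : G q = ⋃ k, {w | Γ [n₀ + q.1, q.2 + k] (φ.tableInput w) ∈ S} := by
      ext w
      rw [Set.mem_iUnion]
      exact Iff.rfl
    rw [this]
    exact isOpen_iUnion fun k => φ.isOpen_setOf_tableInput (hGA _ _) S
  have hdense : ∀ q, Dense (G q) := fun q => by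
    refine φ.dense_setOf_tableInput (Γ := fun k => Γ [n₀ + q.1, q.2 + k]) (fun k => hGA _ _)
      fun A hA => ?_
    have h3 : Metric.infDist z₀ (Γ [n₀ + q.1] A : Set ℂ) < δ / 2 := by
      have h4 := infDist_le_add_dist z₀ (Γ [n₀ + q.1] A) (X (n₀ + q.1) A)
      rw [Metric.infDist_zero_of_mem ((hX A).1 _ hA), dist_comm] at h4
      linarith [(hX A).2.2 (n₀ + q.1), hn₀ (n₀ + q.1) (Nat.le_add_right _ _)]
    obtain ⟨k, hk, hk'⟩ := (((hlim _ A).eventually_lt_const h3).and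
      (eventually_ge_atTop q.2)).exists
    exact ⟨k - q.2, by rwa [Nat.add_sub_cancel' hk']⟩
  obtain ⟨w, hw⟩ := (dense_iInter_of_isOpen hopen hdense).nonempty
  rw [Set.mem_iInter] at hw
  set A := φ.tableInput w
  have h5 : ∀ n, Metric.infDist z₀ (Γ [n₀ + n] A : Set ℂ) ≤ δ / 2 := fun n => by
    by_contra! hlt
    obtain ⟨N₁, hN₁⟩ := eventually_atTop.1 ((hlim (n₀ + n) A).eventually_const_lt hlt)
    obtain ⟨k, hk⟩ := hw (n, N₁)
    exact absurd hk (not_lt.2 (hN₁ (N₁ + k) (Nat.le_add_right _ _)).le)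
  have h6 : Metric.infDist z₀ (P.delta1.Xi A : Set ℂ) ≤ δ / 2 := by
    refine le_of_tendsto (tendsto_infDist z₀ (hX A).2.1) ?_
    filter_upwards [eventually_ge_atTop n₀] with n hn
    have := h5 (n - n₀)
    rwa [Nat.add_sub_cancel' hn] at this
  have h7 := hfar (P.delta1.Xi A) (by
    rw [P.delta1_xi A (φ.isDelta1Info_table w)]
    exact φ.subset_of_some fun m => (w m).1)
  linarith

end AdversarialFamily

end CompProblem

/-! ### Spectral sets of involutions and eigenvectors -/

section SpectralSets

variable {E : Type*} [NormedAddCommGroup E] [NormedSpace ℂ E] {T : E →L[ℂ] E}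

/-- From `T² = 1` follows `1 - z² = (T + z)(T - z)`, and `‖T + z‖ ≤ 1 + ‖z‖`. -/
theorem norm_one_sub_sq_le_of_involutive (hT : ∀ f, T (T f) = f) (hn : ∀ f, ‖T f‖ ≤ ‖f‖) (z : ℂ)
    {f : E} (hf : ‖f‖ = 1) : ‖1 - z ^ 2‖ ≤ (1 + ‖z‖) * ‖T f - z • f‖ := by
  have h1 : (1 - z ^ 2) • f = T (T f - z • f) + z • (T f - z • f) := by
    rw [map_sub, map_smul, hT, sub_smul, one_smul, smul_sub, smul_smul, sq]
    abel
  calc ‖1 - z ^ 2‖ = ‖(1 - z ^ 2) • f‖ := by rw [norm_smul, hf, mul_one]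
    _ ≤ ‖T (T f - z • f)‖ + ‖z • (T f - z • f)‖ := h1 ▸ norm_add_le _ _
    _ ≤ ‖T f - z • f‖ + ‖z‖ * ‖T f - z • f‖ := add_le_add (hn _) (norm_smul _ _).le
    _ = (1 + ‖z‖) * ‖T f - z • f‖ := by ring

/-- A closed set that contains the pseudospectrum of any contractive involution. -/
def involutionBound (ε : ℝ) : Set ℂ := {z | ‖1 - z ^ 2‖ ≤ (1 + ‖z‖) * ε}

theorem isClosed_involutionBound (ε : ℝ) : IsClosed (involutionBound ε) :=
  isClosed_le (by fun_prop) (by fun_prop)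

theorem sigmaApEps_subset_involutionBound (hT : ∀ f, T (T f) = f) (hn : ∀ f, ‖T f‖ ≤ ‖f‖)
    (ε : ℝ) : sigmaApEps ε T ⊆ involutionBound ε := by
  refine closure_minimal ?_ (isClosed_involutionBound ε)
  rintro z ⟨f, hf, hlt⟩
  exact (norm_one_sub_sq_le_of_involutive hT hn z hf).trans
    (mul_le_mul_of_nonneg_left hlt.le (by positivity))

theorem sigmaAp_subset_involutionBound (hT : ∀ f, T (T f) = f) (hn : ∀ f, ‖T f‖ ≤ ‖f‖) :
    sigmaAp T ⊆ involutionBound 0 := by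
  rintro z ⟨f, hf, hlim⟩
  have h : Tendsto (fun n => (1 + ‖z‖) * ‖T (f n) - z • f n‖) atTop (𝓝 ((1 + ‖z‖) * 0)) :=
    hlim.const_mul _
  exact ge_of_tendsto h (Eventually.of_forall fun n =>
    norm_one_sub_sq_le_of_involutive hT hn z (hf n))

/-- At this point the two sides are `2 + 2ε + ε²` and `2ε + ε²`. -/
theorem mul_I_notMem_involutionBound {ε : ℝ} (hε : 0 ≤ ε) :
    ((1 + ε : ℝ) : ℂ) * Complex.I ∉ involutionBound ε := by
  have h1 : 1 - (((1 + ε : ℝ) : ℂ) * Complex.I) ^ 2 = ((1 + (1 + ε) ^ 2 : ℝ) : ℂ) := by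
    rw [mul_pow, Complex.I_sq]
    push_cast
    ring
  have h2 : ‖((1 + ε : ℝ) : ℂ) * Complex.I‖ = 1 + ε := by
    rw [norm_mul, Complex.norm_I, mul_one, Complex.norm_real, Real.norm_of_nonneg (by positivity)]
  rw [involutionBound, Set.mem_ofPred_eq, h1, h2, Complex.norm_real,
    Real.norm_of_nonneg (by positivity)]
  nlinarith

theorem exists_unit_eigenvector {z : ℂ} (h : ∃ f ≠ 0, T f = z • f) :
    ∃ f, ‖f‖ = 1 ∧ T f = z • f := by
  obtain ⟨f, hf, hTf⟩ := h
  refine ⟨((‖f‖⁻¹ : ℝ) : ℂ) • f, ?_, by rw [map_smul, hTf, smul_comm]⟩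
  rw [norm_smul, Complex.norm_real, norm_inv, norm_norm, inv_mul_cancel₀ (norm_ne_zero_iff.2 hf)]

theorem mem_sigmaAp_of_eigenvector {z : ℂ} (h : ∃ f ≠ 0, T f = z • f) : z ∈ sigmaAp T := by
  obtain ⟨f, hf, hTf⟩ := exists_unit_eigenvector h
  exact ⟨fun _ => f, fun _ => hf, by simp [hTf]⟩

theorem mul_mem_sigmaApEps_of_eigenvector {z : ℂ} (hz : ‖z‖ = 1) (h : ∃ f ≠ 0, T f = z • f)
    {ε : ℝ} (hε : 0 < ε) : ((1 + ε : ℝ) : ℂ) * z ∈ sigmaApEps ε T := by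
  obtain ⟨f, hf, hTf⟩ := exists_unit_eigenvector h
  refine Metric.mem_closure_iff.2 fun r hr => ?_
  -- This `t` satisfies `0 < t < ε`, as the strict inequality needs, and differs from `ε` by less
  -- than `r`.
  set t := ε - min ε r / 2 with ht
  have hm : 0 < min ε r := lt_min hε hr
  have hm1 := min_le_left ε r
  have hm2 := min_le_right ε r
  refine ⟨((1 + t : ℝ) : ℂ) * z, ⟨f, hf, ?_⟩, ?_⟩
  · have h1 : T f - (((1 + t : ℝ) : ℂ) * z) • f = ((-t : ℝ) : ℂ) • z • f := by
      rw [hTf, smul_smul, ← sub_smul]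
      congr 1
      push_cast
      ring
    rw [h1, norm_smul, norm_smul, hz, hf, Complex.norm_real, Real.norm_eq_abs, abs_neg,
      abs_of_nonneg (by linarith)]
    linarith
  · rw [dist_eq_norm, ← sub_mul, norm_mul, hz, mul_one, ← Complex.ofReal_sub, Complex.norm_real,
      Real.norm_of_nonneg (by linarith)]
    linarith

end SpectralSets

/-! ### Koopman operators of involutions and their eigenvectors -/

section KoopmanSpectra

variable {X : Type*} [MetricSpace X] [MeasurableSpace X] [BorelSpace X] {p : ℝ≥0∞} {ω : Measure X}
  [Fact (1 ≤ p)]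

theorem norm_koopman_le {F : C(X, X)} (hF : F ∈ measurePreservingClass ω)
    (hF' : F ∈ generalClass p ω) (f : Lp ℂ p ω) : ‖koopman F hF' f‖ ≤ ‖f‖ := by
  have hmp : MeasurePreserving F ω ω := ⟨F.continuous.measurable, hF⟩
  rw [Lp.norm_def, Lp.norm_def, eLpNorm_congr_ae (koopman_coeFn F hF' f),
    eLpNorm_comp_measurePreserving (Lp.memLp f).1 hmp]

theorem koopman_koopman {F : C(X, X)} (hF : F ∈ generalClass p ω) (hinv : ∀ x, F (F x) = x)
    (f : Lp ℂ p ω) : koopman F hF (koopman F hF f) = f := by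
  refine Lp.ext ?_
  filter_upwards [koopman_coeFn F hF (koopman F hF f),
    (quasiMeasurePreserving_of_mem hF).ae_eq_comp (koopman_coeFn F hF f)] with x h1 h2
  rw [h1, h2, Function.comp_apply, Function.comp_apply, hinv]

theorem exists_koopman_eigenvector [IsFiniteMeasure ω] {F : C(X, X)} (hF : F ∈ generalClass p ω)
    {u : X → ℂ} (hu : Measurable u) (hb : ∀ x, ‖u x‖ ≤ 1) (hpos : ω {x | u x ≠ 0} ≠ 0) {z : ℂ}
    (huF : ∀ x, u (F x) = z * u x) : ∃ f : Lp ℂ p ω, f ≠ 0 ∧ koopman F hF f = z • f := by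
  have hmem : MemLp u p ω :=
    .of_bound hu.aestronglyMeasurable 1 (Eventually.of_forall hb)
  refine ⟨hmem.toLp u, fun h0 => hpos ?_, Lp.ext ?_⟩
  · exact ae_iff.1 (hmem.coeFn_toLp.symm.trans (h0 ▸ Lp.coeFn_zero ℂ p ω))
  · filter_upwards [koopman_coeFn F hF (hmem.toLp u), hmem.coeFn_toLp,
      (quasiMeasurePreserving_of_mem hF).ae_eq_comp hmem.coeFn_toLp,
      Lp.coeFn_smul z (hmem.toLp u)] with x h1 h2 h3 h4
    rw [h1, h3, h4, Pi.smul_apply, h2, Function.comp_apply, huF, smul_eq_mul]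

end KoopmanSpectra

/-! ### Skew products over the Cantor set -/

namespace CantorSkew

/-- The points of the Cantor space whose first coordinate `true` is the `m`-th one. -/
def cell (m : ℕ) : Set (ℕ → Bool) := {y | y m = true ∧ ∀ i < m, y i = false}

theorem isClopen_cell (m : ℕ) : IsClopen (cell m) := by
  have h : cell m = (fun y => y m) ⁻¹' {true} ∩ ⋂ i ∈ Finset.range m, (fun y => y i) ⁻¹' {false} := by
    ext y
    simp [cell]
  rw [h]
  exact ((isClopen_discrete _).preimage (continuous_apply m)).inter
    (isClopen_biInter_finset fun i _ => (isClopen_discrete _).preimage (continuous_apply i))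

theorem cell_nonempty (m : ℕ) : (cell m).Nonempty :=
  ⟨fun i => decide (i = m), by simp, fun i hi => by simp [hi.ne]⟩

theorem eq_of_mem_cell {y : ℕ → Bool} {m n : ℕ} (hm : y ∈ cell m) (hn : y ∈ cell n) : m = n := by
  rcases lt_trichotomy m n with h | h | h
  · exact absurd hm.1 (by simp [hn.2 m h])
  · exact h
  · exact absurd hn.1 (by simp [hm.2 n h])

/-- The local data: a coordinate to be flipped, and a clopen set. -/
abbrev Datum : Type := ℕ × Clopens (ℕ × ℕ → Bool)

/-- The coordinates flipped over the `m`-th cell. -/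
def flip (m : ℕ) : Option Datum → ℕ × ℕ → Bool
  | none => 0
  | some d => Pi.single (m, d.1) true

/-- The amount of rotation over the `m`-th cell. -/
noncomputable def sign (m : ℕ) : Option Datum → (ℕ × ℕ → Bool) → ℝ
  | none => 1
  | some d => fun w => (d.2 : Set (ℕ × ℕ → Bool)).indicator 1 w -
      (d.2 : Set (ℕ × ℕ → Bool)).indicator 1 (w + flip m (some d))

theorem add_self_eq_zero (v : ℕ × ℕ → Bool) : v + v = 0 := by
  funext q
  change v q + v q = 0
  cases v q <;> rfl

/-- The flip has order two and so exchanges the two indicators. -/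
theorem sign_add_flip (m : ℕ) (d : Datum) (w : ℕ × ℕ → Bool) :
    sign m (some d) (w + flip m (some d)) = -sign m (some d) w := by
  simp only [sign]
  rw [add_assoc, add_self_eq_zero, add_zero, neg_sub]

theorem continuous_indicator_one {α : Type*} [TopologicalSpace α] {s : Set α} (hs : IsClopen s) :
    Continuous (s.indicator (1 : α → ℝ)) :=
  continuous_one.indicator (by simp [hs.frontier_eq])

theorem continuous_sign (m : ℕ) (o : Option Datum) : Continuous (sign m o) := by
  cases o with
  | none => exact continuous_const
  | some d =>
    exact (continuous_indicator_one d.2.isClopen).sub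
      ((continuous_indicator_one d.2.isClopen).comp (continuous_id.add continuous_const))

theorem abs_sign_le (m : ℕ) (o : Option Datum) (w : ℕ × ℕ → Bool) : |sign m o w| ≤ 1 := by
  cases o with
  | none => simp [sign]
  | some d =>
    simp only [sign, Set.indicator]
    split_ifs <;> simp

/-- The coordinates flipped in the fibre over `y`. -/
noncomputable def shift (s : ℕ → Option Datum) (y : ℕ → Bool) : ℕ × ℕ → Bool :=
  open Classical in fun q => if y ∈ cell q.1 then flip q.1 (s q.1) q else false

theorem shift_of_mem (s : ℕ → Option Datum) {y : ℕ → Bool} {m : ℕ} (hy : y ∈ cell m) :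
    shift s y = flip m (s m) := by
  funext q
  by_cases hq : q.1 = m
  · simp [shift, hq, hy]
  · have h1 : y ∉ cell q.1 := fun h => hq (eq_of_mem_cell h hy)
    simp only [shift, h1, if_false]
    cases s m with
    | none => rfl
    | some d =>
      change false = (Pi.single (m, d.1) true : ℕ × ℕ → Bool) q
      rw [Pi.single_eq_of_ne fun h => hq (by rw [h])]
      rfl

theorem shift_of_forall_notMem (s : ℕ → Option Datum) {y : ℕ → Bool} (hy : ∀ m, y ∉ cell m) :
    shift s y = 0 := by
  funext q
  simp only [shift, hy q.1, if_false]
  rfl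

theorem continuous_shift (s : ℕ → Option Datum) : Continuous (shift s) := by
  classical
  refine continuous_pi fun q => ?_
  exact continuous_const.if (by simp [(isClopen_cell q.1).frontier_eq]) continuous_const

/-- The rotation angle at a point of the Cantor space. -/
noncomputable def angle (s : ℕ → Option Datum) (v : (ℕ → Bool) × (ℕ × ℕ → Bool)) : ℝ :=
  ∑' m : ℕ, (cell m).indicator 1 v.1 * ((1 / 4 : ℝ) ^ (m + 1) * sign m (s m) v.2)

theorem angle_of_mem (s : ℕ → Option Datum) {v : (ℕ → Bool) × (ℕ × ℕ → Bool)} {m : ℕ}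
    (hv : v.1 ∈ cell m) : angle s v = (1 / 4 : ℝ) ^ (m + 1) * sign m (s m) v.2 := by
  rw [angle, tsum_eq_single m fun n hn => ?_]
  · simp [hv]
  · have : v.1 ∉ cell n := fun h => hn (eq_of_mem_cell h hv)
    simp [this]

theorem angle_of_forall_notMem (s : ℕ → Option Datum) {v : (ℕ → Bool) × (ℕ × ℕ → Bool)}
    (hv : ∀ m, v.1 ∉ cell m) : angle s v = 0 := by
  simp [angle, hv]

/-- The factors `4^{-(m+1)}` make the series converge uniformly, hence continuity also where the
cells accumulate. -/
theorem continuous_angle (s : ℕ → Option Datum) : Continuous (angle s) := by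
  refine continuous_tsum (u := fun m : ℕ => (1 / 4 : ℝ) ^ (m + 1)) (fun m => ?_) ?_ fun m v => ?_
  · exact ((continuous_indicator_one (isClopen_cell m)).comp continuous_fst).mul
      (continuous_const.mul ((continuous_sign m (s m)).comp continuous_snd))
  · exact (summable_nat_add_iff 1).2 (summable_geometric_of_lt_one (by norm_num) (by norm_num))
  · have h1 : |(cell m).indicator (1 : (ℕ → Bool) → ℝ) v.1| ≤ 1 := by
      simp only [Set.indicator]
      split_ifs <;> simp
    have h2 : |(1 / 4 : ℝ) ^ (m + 1)| = (1 / 4 : ℝ) ^ (m + 1) := abs_of_nonneg (by positivity)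
    rw [Real.norm_eq_abs, abs_mul, abs_mul, h2]
    have h3 := abs_sign_le m (s m) v.2
    calc _ ≤ 1 * ((1 / 4 : ℝ) ^ (m + 1) * 1) := by gcongr
      _ = _ := by ring

/-- The Cantor set as a product of Cantor spaces. -/
noncomputable def homeo : cantorSet ≃ₜ (ℕ → Bool) × (ℕ × ℕ → Bool) :=
  cantorSetHomeomorphNatToBool.trans
    ((Homeomorph.piCongrLeft (Y := fun _ : ℕ ⊕ ℕ × ℕ => Bool)
      (Denumerable.equiv₂ ℕ (ℕ ⊕ ℕ × ℕ))).trans Homeomorph.sumArrowHomeomorphProdArrow)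

/-- The skew product with rotation angle `angle s` and fibre translation `shift s`. -/
noncomputable def skew (s : ℕ → Option Datum) :
    C(AddCircle (1 : ℝ) × cantorSet, AddCircle (1 : ℝ) × cantorSet) where
  toFun x := (x.1 + (angle s (homeo x.2) : ℝ),
    homeo.symm ((homeo x.2).1, (homeo x.2).2 + shift s (homeo x.2).1))
  continuous_toFun := by
    have h := homeo.continuous.comp (continuous_snd (X := AddCircle (1 : ℝ)) (Y := cantorSet))
    refine (continuous_fst.add ((AddCircle.continuous_mk' 1).comp
      ((continuous_angle s).comp h))).prodMk (homeo.symm.continuous.comp ?_)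
    exact h.fst.prodMk (h.snd.add ((continuous_shift s).comp h.fst))

theorem skew_apply (s : ℕ → Option Datum) (x : AddCircle (1 : ℝ) × cantorSet) :
    skew s x = (x.1 + (angle s (homeo x.2) : ℝ),
      homeo.symm ((homeo x.2).1, (homeo x.2).2 + shift s (homeo x.2).1)) := rfl

theorem skew_of_mem (s : ℕ → Option Datum) {x : AddCircle (1 : ℝ) × cantorSet} {m : ℕ}
    (hx : (homeo x.2).1 ∈ cell m) :
    skew s x = (x.1 + ((1 / 4 : ℝ) ^ (m + 1) * sign m (s m) (homeo x.2).2 : ℝ),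
      homeo.symm ((homeo x.2).1, (homeo x.2).2 + flip m (s m))) := by
  rw [skew_apply, angle_of_mem s hx, shift_of_mem s hx]

theorem skew_of_forall_notMem (s : ℕ → Option Datum) {x : AddCircle (1 : ℝ) × cantorSet}
    (hx : ∀ m, (homeo x.2).1 ∉ cell m) : skew s x = x := by
  rw [skew_apply, angle_of_forall_notMem s hx, shift_of_forall_notMem s hx]
  simp

/-- The second flip undoes the first, and by oddness of `sign` the second rotation is inverse to the
first. -/
theorem skew_skew (s : ℕ → Datum) (x : AddCircle (1 : ℝ) × cantorSet) :
    skew (fun m => some (s m)) (skew (fun m => some (s m)) x) = x := by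
  by_cases hx : ∃ m, (homeo x.2).1 ∈ cell m
  · obtain ⟨m, hm⟩ := hx
    rw [skew_of_mem _ hm, skew_of_mem (m := m) _ (by simpa using hm)]
    simp only [Homeomorph.apply_symm_apply, sign_add_flip, add_assoc, add_self_eq_zero, add_zero,
      ← AddCircle.coe_add]
    simp
  · rw [not_exists] at hx
    rw [skew_of_forall_notMem _ hx, skew_of_forall_notMem _ hx]

open Classical in
/-- The index of the cell over which a point lies. -/
noncomputable def coord (x : AddCircle (1 : ℝ) × cantorSet) : ℕ :=
  if h : ∃ m, (homeo x.2).1 ∈ cell m then h.choose else 0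

theorem coord_of_mem {x : AddCircle (1 : ℝ) × cantorSet} {m : ℕ} (hx : (homeo x.2).1 ∈ cell m) :
    coord x = m := by
  have h : ∃ m, (homeo x.2).1 ∈ cell m := ⟨m, hx⟩
  rw [coord, dif_pos h]
  exact eq_of_mem_cell h.choose_spec hx

theorem skew_congr {s t : ℕ → Option Datum} {x : AddCircle (1 : ℝ) × cantorSet}
    (h : s (coord x) = t (coord x)) : skew s x = skew t x := by
  by_cases hx : ∃ m, (homeo x.2).1 ∈ cell m
  · obtain ⟨m, hm⟩ := hx
    rw [coord_of_mem hm] at h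
    rw [skew_of_mem s hm, skew_of_mem t hm, h]
  · rw [not_exists] at hx
    rw [skew_of_forall_notMem s hx, skew_of_forall_notMem t hx]

theorem tendsto_single_true (ι : Type*) [DecidableEq ι] :
    Tendsto (fun i => (Pi.single i true : ι → Bool)) cofinite (𝓝 0) := by
  refine tendsto_pi_nhds.2 fun j => tendsto_const_nhds.congr' ?_
  filter_upwards [(Set.finite_singleton j).compl_mem_cofinite] with i hi
  rw [Pi.single_eq_of_ne fun h => hi h.symm]
  rfl

theorem tendsto_single_prodMk (m : ℕ) :
    Tendsto (fun l => (Pi.single (m, l) true : ℕ × ℕ → Bool)) atTop (𝓝 0) := by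
  have h : Function.Injective fun l : ℕ => (m, l) := fun _ _ h => (Prod.ext_iff.1 h).2
  have h' := (tendsto_single_true (ℕ × ℕ)).comp h.tendsto_cofinite
  rwa [Nat.cofinite_eq_atTop] at h'

/-- Flipping a far coordinate hardly moves the sample points. A clopen set containing them but not
their flips gives `sign` the value `1` there, so the rotation is that of `none`. -/
theorem exists_skew_update_approx {s : ℕ → Option Datum} {m : ℕ} (hs : s m = none)
    (E : Finset (AddCircle (1 : ℝ) × cantorSet)) {η : ℝ} (hη : 0 < η) :
    ∃ d : Datum, ∀ x ∈ E, dist (skew s x) (skew (Function.update s m (some d)) x) ≤ η := by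
  classical
  have h1 : ∀ x ∈ E, ∀ᶠ l in atTop, dist (homeo.symm ((homeo x.2).1, (homeo x.2).2))
      (homeo.symm ((homeo x.2).1, (homeo x.2).2 + Pi.single (m, l) true)) < η := fun x _ => by
    have h := (tendsto_single_prodMk m).const_add (homeo x.2).2
    rw [add_zero] at h
    have h' := (homeo.symm.continuous.tendsto _).comp
      ((tendsto_const_nhds (x := (homeo x.2).1)).prodMk_nhds h)
    filter_upwards [h'.eventually (Metric.ball_mem_nhds _ hη)] with l hl
    rw [dist_comm]
    exact hl
  -- No sample may be the flip of another; otherwise no set could separate samples from flips.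
  have h2 : ∀ x ∈ E, ∀ᶠ l in atTop, ∀ x' ∈ E,
      (homeo x.2).2 ≠ (homeo x'.2).2 + Pi.single (m, l) true := fun x _ => by
    refine (Finset.eventually_all _).2 fun x' _ => ?_
    by_cases hxx : (homeo x.2).2 = (homeo x'.2).2
    · refine Eventually.of_forall fun l h => ?_
      rw [hxx, left_eq_add] at h
      have := congrFun h (m, l)
      rw [Pi.single_eq_same] at this
      exact Bool.noConfusion this
    · have h := (tendsto_single_prodMk m).const_add (homeo x'.2).2
      rw [add_zero] at h
      filter_upwards [h.eventually_ne (Ne.symm hxx)] with l hl using hl.symm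
  obtain ⟨l, hl1, hl2⟩ := (((Finset.eventually_all _).2 h1).and
    ((Finset.eventually_all _).2 h2)).exists
  have hfin : ∀ g : AddCircle (1 : ℝ) × cantorSet → ℕ × ℕ → Bool, IsClosed (g '' E) := fun g =>
    (E.finite_toSet.image g).isClosed
  obtain ⟨W, hW, hW1, hW2⟩ := exists_clopen_of_closed_subset_open
    (hfin fun x => (homeo x.2).2)
    (hfin fun x => (homeo x.2).2 + Pi.single (m, l) true).isOpen_compl (by
      rintro - ⟨x, hx, rfl⟩ ⟨x', hx', h⟩
      exact hl2 x hx x' hx' h.symm)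
  refine ⟨(l, ⟨W, hW⟩), fun x hx => ?_⟩
  by_cases hm : (homeo x.2).1 ∈ cell m
  · have h3 : (homeo x.2).2 ∈ W := hW1 ⟨x, hx, rfl⟩
    have h4 : (homeo x.2).2 + Pi.single (m, l) true ∉ W := fun h => hW2 h ⟨x, hx, rfl⟩
    have h5 : sign m (some (l, ⟨W, hW⟩)) (homeo x.2).2 = 1 := by
      simp [sign, flip, h3, h4]
    rw [skew_of_mem _ hm, skew_of_mem _ hm, hs, Function.update_self, h5, Prod.dist_eq]
    refine max_le ?_ ?_
    · simp only [sign, Pi.one_apply, dist_self]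
      exact hη.le
    · simp only [flip, add_zero]
      exact (hl1 x hx).le
  · by_cases hc : ∃ n, (homeo x.2).1 ∈ cell n
    · obtain ⟨n, hn⟩ := hc
      have hnm : n ≠ m := fun h => hm (h ▸ hn)
      rw [skew_congr (t := Function.update s m (some (l, ⟨W, hW⟩)))
        (by rw [coord_of_mem hn, Function.update_of_ne hnm]), dist_self]
      exact hη.le
    · rw [not_exists] at hc
      rw [skew_of_forall_notMem _ hc, skew_of_forall_notMem _ hc, dist_self]
      exact hη.le

end CantorSkew

/-! ### Invariant measure, eigenfunctions and lower bounds for the skew products -/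

namespace CantorSkew

/-- The Haar probability measure of the group `ι → Bool`. -/
noncomputable def coinMeasure (ι : Type) [Countable ι] : Measure (ι → Bool) :=
  Measure.addHaarMeasure ⊤

variable {ι : Type} [Countable ι]

instance : (coinMeasure ι).IsAddHaarMeasure :=
  inferInstanceAs (Measure.addHaarMeasure ⊤).IsAddHaarMeasure

instance : IsProbabilityMeasure (coinMeasure ι) := ⟨Measure.addHaarMeasure_self⟩

/-- The points with a single coordinate `true` accumulate at `0`, so the group is not discrete and
its Haar measure has no atoms. -/
instance [Infinite ι] : NullSingletonClass (coinMeasure ι) := by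
  have : (𝓝[≠] (0 : ι → Bool)).NeBot := by
    classical
    refine NeBot.mono (f := map (fun i => (Pi.single i true : ι → Bool)) cofinite) inferInstance ?_
    refine tendsto_nhdsWithin_iff.2 ⟨tendsto_single_true ι, Eventually.of_forall fun i h => ?_⟩
    have := congrFun h i
    rw [Pi.single_eq_same] at this
    exact Bool.noConfusion this
  infer_instance

/-- The measure on the Cantor set that corresponds to the product of the Haar measures. -/
noncomputable def cantorMeasure : Measure cantorSet :=
  ((coinMeasure ℕ).prod (coinMeasure (ℕ × ℕ))).map homeo.symm

theorem measurePreserving_homeo_symm :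
    MeasurePreserving homeo.symm ((coinMeasure ℕ).prod (coinMeasure (ℕ × ℕ))) cantorMeasure :=
  ⟨homeo.symm.continuous.measurable, rfl⟩

theorem measurePreserving_homeo :
    MeasurePreserving homeo cantorMeasure ((coinMeasure ℕ).prod (coinMeasure (ℕ × ℕ))) :=
  measurePreserving_homeo_symm.symm homeo.symm.toMeasurableEquiv

instance : IsProbabilityMeasure cantorMeasure :=
  Measure.isProbabilityMeasure_map homeo.symm.continuous.aemeasurable

instance : NullSingletonClass cantorMeasure := ⟨fun x => by
  have h : homeo.symm ⁻¹' {x} = {homeo x} := by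
    ext v
    rw [Set.mem_preimage, Set.mem_singleton_iff, Set.mem_singleton_iff, Homeomorph.symm_apply_eq]
  rw [cantorMeasure, Measure.map_apply homeo.symm.continuous.measurable (measurableSet_singleton x),
    h]
  exact measure_singleton _⟩

/-- The product of the Haar measure of the circle and the measure on the Cantor set. -/
noncomputable abbrev skewMeasure : Measure (AddCircle (1 : ℝ) × cantorSet) :=
  (AddCircle.haarAddCircle (T := (1 : ℝ))).prod cantorMeasure

/-- Two nested skew products by fibre translations, each preserving Haar measure; the swaps make the
circle the fibre. -/
theorem measurePreserving_skew (s : ℕ → Option Datum) :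
    MeasurePreserving (skew s) skewMeasure skewMeasure := by
  have h1 : MeasurePreserving
      (fun v : (ℕ → Bool) × (ℕ × ℕ → Bool) => (id v.1, v.2 + shift s v.1))
      ((coinMeasure ℕ).prod (coinMeasure (ℕ × ℕ))) ((coinMeasure ℕ).prod (coinMeasure (ℕ × ℕ))) :=
    (MeasurePreserving.id _).skew_product (g := fun y w => w + shift s y)
      (continuous_snd.add ((continuous_shift s).comp continuous_fst)).measurable
      (Eventually.of_forall fun y => map_add_right_eq_self _ _)
  have h2 := measurePreserving_homeo_symm.comp (h1.comp measurePreserving_homeo)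
  have h3 := h2.skew_product (μc := AddCircle.haarAddCircle (T := (1 : ℝ)))
    (μd := AddCircle.haarAddCircle (T := (1 : ℝ)))
    (g := fun k θ => θ + ((angle s (homeo k) : ℝ) : AddCircle (1 : ℝ)))
    (continuous_snd.add ((AddCircle.continuous_mk' 1).comp
      ((continuous_angle s).comp (homeo.continuous.comp continuous_fst)))).measurable
    (Eventually.of_forall fun k => map_add_right_eq_self _ _)
  have h4 := (Measure.measurePreserving_swap.comp h3).comp (Measure.measurePreserving_swap
    (μ := AddCircle.haarAddCircle (T := (1 : ℝ))) (ν := cantorMeasure))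
  exact h4

/-- An eigenfunction of the skew product if the datum at the index `m` is `none`. -/
noncomputable def eigenfunction (m : ℕ) (x : AddCircle (1 : ℝ) × cantorSet) : ℂ :=
  ((fun x : AddCircle (1 : ℝ) × cantorSet => (homeo x.2).1) ⁻¹' cell m).indicator
    (fun x => fourier (4 ^ m) x.1) x

theorem eigenfunction_of_mem {m : ℕ} {x : AddCircle (1 : ℝ) × cantorSet}
    (hx : (homeo x.2).1 ∈ cell m) : eigenfunction m x = fourier (4 ^ m) x.1 := by
  rw [eigenfunction, Set.indicator_of_mem]
  exact hx

theorem eigenfunction_of_notMem {m : ℕ} {x : AddCircle (1 : ℝ) × cantorSet}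
    (hx : (homeo x.2).1 ∉ cell m) : eigenfunction m x = 0 := by
  rw [eigenfunction, Set.indicator_of_notMem]
  exact hx

theorem eigenfunction_skew {s : ℕ → Option Datum} {m : ℕ} (hs : s m = none)
    (x : AddCircle (1 : ℝ) × cantorSet) :
    eigenfunction m (skew s x) = Complex.I * eigenfunction m x := by
  by_cases hx : (homeo x.2).1 ∈ cell m
  · have h1 : (homeo (skew s x).2).1 ∈ cell m := by simpa [skew_apply] using hx
    rw [eigenfunction_of_mem h1, eigenfunction_of_mem hx, skew_of_mem s hx, hs]
    -- The frequency `4^m` turns the rotation by `4^{-(m+1)}` into a quarter turn, whatever `m` is.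
    have h2 : (fourier (4 ^ m) : C(AddCircle (1 : ℝ), ℂ))
        (((1 / 4 : ℝ) ^ (m + 1) * sign m none (homeo x.2).2 : ℝ) : AddCircle (1 : ℝ)) =
        Complex.I := by
      rw [fourier_coe_apply]
      conv_rhs => rw [← Complex.exp_pi_div_two_mul_I]
      congr 1
      have h4 : (4 : ℂ) ^ m * (1 / 4) ^ (m + 1) = 1 / 4 := by
        rw [pow_succ, ← mul_assoc, ← mul_pow]
        norm_num
      simp only [sign, Pi.one_apply]
      push_cast
      linear_combination 2 * Real.pi * Complex.I * h4
    have h3 : ∀ a b : AddCircle (1 : ℝ), (fourier (4 ^ m) : C(AddCircle (1 : ℝ), ℂ)) (a + b) =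
        fourier (4 ^ m) a * fourier (4 ^ m) b := fun a b => by
      simp only [fourier_apply, smul_add, AddCircle.toCircle_add, Circle.coe_mul]
    rw [h3, h2, mul_comm]
  · have h1 : (homeo (skew s x).2).1 ∉ cell m := by simpa [skew_apply] using hx
    rw [eigenfunction_of_notMem h1, eigenfunction_of_notMem hx, mul_zero]

theorem measurable_eigenfunction (m : ℕ) : Measurable (eigenfunction m) := by
  have h : Continuous fun x : AddCircle (1 : ℝ) × cantorSet => (homeo x.2).1 :=
    (homeo.continuous.comp continuous_snd).fst
  exact ((fourier (4 ^ m)).continuous.comp continuous_fst).measurable.indicator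
    (h.measurable (isClopen_cell m).isOpen.measurableSet)

theorem norm_eigenfunction_le (m : ℕ) (x : AddCircle (1 : ℝ) × cantorSet) :
    ‖eigenfunction m x‖ ≤ 1 := by
  refine (norm_indicator_le_norm_self _ _).trans ?_
  rw [fourier_apply, Circle.norm_coe]

theorem measure_eigenfunction_ne_zero (m : ℕ) :
    skewMeasure {x | eigenfunction m x ≠ 0} ≠ 0 := by
  have h : {x | eigenfunction m x ≠ 0} =
      (Set.univ : Set (AddCircle (1 : ℝ))) ×ˢ (homeo ⁻¹' (cell m ×ˢ Set.univ)) := by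
    ext x
    simp [eigenfunction, Set.indicator_apply_eq_zero, fourier_apply]
  rw [h, Measure.prod_prod, measurePreserving_homeo.measure_preimage
    ((isClopen_cell m).isOpen.measurableSet.prod .univ).nullMeasurableSet, Measure.prod_prod]
  simpa using (isClopen_cell m).isOpen.measure_ne_zero (coinMeasure ℕ) (cell_nonempty m)

variable {p : ℝ≥0∞} [Fact (1 ≤ p)]

/-- The skew products form an adversarial family for any spectral set that contains `z₀` if `i` is
an eigenvalue and is contained in `N` for contractive involutions. -/
noncomputable def adversarialFamily (spec : (Lp ℂ p skewMeasure →L[ℂ] Lp ℂ p skewMeasure) → NonemptyCompacts ℂ)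
    (S : Set C(AddCircle (1 : ℝ) × cantorSet, AddCircle (1 : ℝ) × cantorSet))
    (hS : S ⊆ generalClass p skewMeasure) (hmp : measurePreservingClass skewMeasure ⊆ S) (z₀ : ℂ) (N : Set ℂ)
    (hmem : ∀ T, (∃ f ≠ 0, T f = Complex.I • f) → z₀ ∈ (spec T : Set ℂ))
    (hsub : ∀ T, (∀ f, T (T f) = f) → (∀ f, ‖T f‖ ≤ ‖f‖) → (spec T : Set ℂ) ⊆ N) :
    (koopmanProblem spec S hS).AdversarialFamily Datum z₀ N where
  input s := ⟨skew s, hmp (measurePreserving_skew s).map_eq⟩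
  coord := coord
  eval_congr _ _ _ h := skew_congr h
  mem_of_none _ m hs := hmem _ (exists_koopman_eigenvector _ (measurable_eigenfunction m)
    (norm_eigenfunction_le m) (measure_eigenfunction_ne_zero m) (eigenfunction_skew hs))
  subset_of_some s := hsub _ (koopman_koopman _ (skew_skew s))
    (norm_koopman_le (measurePreserving_skew _).map_eq _)
  exists_approx _ _ hs E _ hη := exists_skew_update_approx hs E hη

theorem not_sigmaApEps_inSigma_one {ε : ℝ} (hε : 0 < ε)
    (S : Set C(AddCircle (1 : ℝ) × cantorSet, AddCircle (1 : ℝ) × cantorSet))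
    (hS : S ⊆ generalClass p skewMeasure) (hmp : measurePreservingClass skewMeasure ⊆ S) :
    ¬ (koopmanProblem (sigmaApEpsCompact ε hε) S hS).delta1.InSigma 1 :=
  (adversarialFamily (sigmaApEpsCompact ε hε) S hS hmp (((1 + ε : ℝ) : ℂ) * Complex.I)
    (involutionBound ε) (fun _ h => mul_mem_sigmaApEps_of_eigenvector Complex.norm_I h hε)
    fun _ h h' => sigmaApEps_subset_involutionBound h h' ε).not_inSigma_one
    (isClosed_involutionBound ε) (mul_I_notMem_involutionBound hε.le)

theorem not_sigmaAp_inPi_two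
    (S : Set C(AddCircle (1 : ℝ) × cantorSet, AddCircle (1 : ℝ) × cantorSet))
    (hS : S ⊆ generalClass p skewMeasure) (hmp : measurePreservingClass skewMeasure ⊆ S) :
    ¬ (koopmanProblem sigmaApCompact S hS).delta1.InPi 2 :=
  (adversarialFamily sigmaApCompact S hS hmp Complex.I (involutionBound 0)
    (fun _ h => mem_sigmaAp_of_eigenvector h)
    fun _ h h' => sigmaAp_subset_involutionBound h h').not_inPi_two
    (isClosed_involutionBound 0) (by simpa using mul_I_notMem_involutionBound le_rfl)

end CantorSkew

theorem corollary5p8 :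
    (∀ (p : ℝ≥0∞) [Fact (1 ≤ p)], 1 < p → p ≠ 2 → p < ∞ →
      ∀ (ε : ℝ) (hε : 0 < ε) (X : Type*) [MetricSpace X] [CompactSpace X] [MeasurableSpace X]
        [BorelSpace X] (ω : Measure X) [IsFiniteMeasure ω] [NeZero ω],
        (apEpsMeasurePreserving p ω ε hε).InSigma 2 ∧
        (apMeasurePreserving p ω).InPi 3 ∧
        (apEpsGeneral p ω ε hε).InSigma 2 ∧
        (apGeneral p ω).InPi 3) ∧
    ∃ (ν : Measure cantorSet) (_ : IsProbabilityMeasure ν) (_ : NullSingletonClass ν),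
      ∀ (p : ℝ≥0∞) [Fact (1 ≤ p)], 1 < p → p ≠ 2 → p < ∞ →
      ∀ (ε : ℝ) (hε : 0 < ε),
        ¬ (apEpsMeasurePreserving p ((AddCircle.haarAddCircle (T := (1 : ℝ))).prod ν) ε hε).InSigma 1 ∧
        ¬ (apMeasurePreserving p ((AddCircle.haarAddCircle (T := (1 : ℝ))).prod ν)).InPi 2 ∧
        ¬ (apEpsGeneral p ((AddCircle.haarAddCircle (T := (1 : ℝ))).prod ν) ε hε).InSigma 1 ∧
        ¬ (apGeneral p ((AddCircle.haarAddCircle (T := (1 : ℝ))).prod ν)).InPi 2 := by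
  refine ⟨fun p _ _ _ hp ε hε X _ _ _ _ ω _ _ =>
    ⟨koopmanProblem_sigmaApEps_inSigma_two hp.ne hε _ _, koopmanProblem_sigmaAp_inPi_three hp.ne _ _,
      koopmanProblem_sigmaApEps_inSigma_two hp.ne hε _ _,
      koopmanProblem_sigmaAp_inPi_three hp.ne _ _⟩,
    CantorSkew.cantorMeasure, inferInstance, inferInstance, fun p _ _ _ _ ε hε =>
    ⟨CantorSkew.not_sigmaApEps_inSigma_one hε _ _ subset_rfl,
      CantorSkew.not_sigmaAp_inPi_two _ _ subset_rfl,
      CantorSkew.not_sigmaApEps_inSigma_one hε _ _ (measurePreservingClass_subset p _),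
      CantorSkew.not_sigmaAp_inPi_two _ _ (measurePreservingClass_subset p _)⟩⟩
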